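/- Let $d\ge 1$ and let $F$ be the distribution function $F(\boldsymbol x)=\mathbb P(\boldsymbol X\le \boldsymbol x)$ (coordinatewise inequality) of a probability distribution on $\mathbb R^d$ supported on $[0,\infty)^d$. Assume that $F$ is twice continuously differentiable on $(0,\infty)^d$ and that for every compact $S\subset(0,\infty)^d$ there are $\delta_S>0$ and $M_S<\infty$ such that $|\partial_{x_i}F(\boldsymbol y)|\le M_S$ and $|\partial^2_{x_ix_j}F(\boldsymbol y)|\le M_S$ for all $1\le i,j\le d$ and all $\boldsymbol y\in(0,\infty)^d$ with $\|\boldsymbol y-\boldsymbol z\|_1\le\delta_S$ for some $\boldsymbol z\in S$. For positive integers $n$ and $\boldsymbol m=(m_1,\dots,m_d)$, and an i.i.d. sample $\boldsymbol X_1,\dots,\boldsymbol X_n$ from $F$ with empirical distribution function $F_n(\boldsymbol y)=n^{-1}\sum_{i=1}^n\mathbb I\{\boldsymbol X_i\le\boldsymbol y\}$, let \[ F_{\boldsymbol m,n}(\boldsymbol x)=\sum_{\boldsymbol k\in\mathbb N_0^d}F_n\Big(\frac{k_1}{m_1},\dots,\frac{k_d}{m_d}\Big)\prod_{j=1}^d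 e^{-m_jx_j}\frac{(m_jx_j)^{k_j}}{k_j!},\qquad \boldsymbol x\in[0,\infty)^d, \] be the Szász–Mirakyan estimator, and put $m_{\min}=\min_{1\le j\le d}m_j$. Then for every compact $S\subset(0,\infty)^d$ the estimator $F_{\boldsymbol m,n}(\boldsymbol x)$, $\boldsymbol x\in S$, has a finite second moment for all sufficiently large $m_{\min}$ and $n$, and, as $m_{\min}\to\infty$ and $n\to\infty$ (jointly, with no relation imposed between $n$ and $\boldsymbol m$ or among the $m_j$), uniformly in $\boldsymbol x\in S$, \[ \mathbb E[F_{\boldsymbol m,n}(\boldsymbol x)]-F(\boldsymbol x)=\frac12\sum_{j=1}^d\frac{x_j}{m_j}\,\partial^2_{x_jx_j}F(\boldsymbol x)+o\big(m_{\min}^{-1}\big) \] and \[ \operatorname{Var}\big(F_{\boldsymbol m,n}(\boldsymbol x)\big)=n^{-1}F(\boldsymbol x)\{1-F(\boldsymbol x)\}-n^{-1}\sum_{j=1}^d m_j^{-1/2}\,\partial_{x_j}F(\boldsymbol x)\sqrt{\frac{x_j}{\pi}}+o\big(n^{-1}m_{\min}^{-1/2}\big). \] The error terms depend only on $F$, $d$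 and $S$ (not on the probability space carrying the sample). -/

import Mathlib

open MeasureTheory ProbabilityTheory

noncomputable section

namespace SzaszMirakyan

/-- The open orthant `(0, ∞)^d`. -/
def interiorOrthant (d : ℕ) : Set (Fin d → ℝ) := {x | ∀ j, 0 < x j}

/-- The multivariate distribution function `F(x) = μ {y | y ≤ x}` of a law `μ` on `ℝ^d`
(the order on `Fin d → ℝ` is the coordinatewise one). -/
def distFun {d : ℕ} (μ : Measure (Fin d → ℝ)) (x : Fin d → ℝ) : ℝ := μ.real (Set.Iic x)

/-- The first-order partial derivative `∂_{x_i} F (x)`. -/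
def partialDeriv {d : ℕ} (i : Fin d) (F : (Fin d → ℝ) → ℝ) (x : Fin d → ℝ) : ℝ :=
  lineDeriv ℝ F x (Pi.single i 1)

/-- The tube `N_δ(S)`: the points of `(0, ∞)^d` within `ℓ¹`-distance `δ` of some point of `S`. -/
def tube {d : ℕ} (S : Set (Fin d → ℝ)) (δ : ℝ) : Set (Fin d → ℝ) :=
  {y | y ∈ interiorOrthant d ∧ ∃ z ∈ S, ∑ j, |y j - z j| ≤ δ}

/-- `F` is `C²` on `(0, ∞)^d`, with first and second partial derivatives bounded on a tube
around each compact subset of `(0, ∞)^d`. -/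
structure RegularInterior {d : ℕ} (F : (Fin d → ℝ) → ℝ) : Prop where
  contDiffOn : ContDiffOn ℝ 2 F (interiorOrthant d)
  bounded : ∀ S : Set (Fin d → ℝ), IsCompact S → S ⊆ interiorOrthant d →
    ∃ δ > 0, ∃ M : ℝ, ∀ y ∈ tube S δ,
      (∀ i, |partialDeriv i F y| ≤ M) ∧
      (∀ i j, |partialDeriv i (partialDeriv j F) y| ≤ M)

/-- The product-Poisson weight `P_{k,m}(x) = ∏_j exp(-m_j x_j) (m_j x_j)^{k_j} / k_j!`. -/
def poissonWeight {d : ℕ} (k m : Fin d → ℕ) (x : Fin d → ℝ) : ℝ :=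
  ∏ j, (Real.exp (-((m j : ℝ) * x j)) * ((m j : ℝ) * x j) ^ k j / (Nat.factorial (k j) : ℝ))

/-- The empirical distribution function of the data points `X_1, …, X_n`. -/
def empiricalDistFun {d n : ℕ} (X : Fin n → Fin d → ℝ) (y : Fin d → ℝ) : ℝ :=
  (1 / (n : ℝ)) * ∑ i, Set.indicator (Set.Iic y) (fun _ => (1 : ℝ)) (X i)

/-- The Szász–Mirakyan estimator `F_{m,n}(x) = ∑_{k ∈ ℕ₀^d} F_n(k/m) P_{k,m}(x)` built from the
data points `X_1, …, X_n`. -/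
def estimator {d n : ℕ} (m : Fin d → ℕ) (X : Fin n → Fin d → ℝ) (x : Fin d → ℝ) : ℝ :=
  ∑' k : Fin d → ℕ, empiricalDistFun X (fun j => (k j : ℝ) / (m j : ℝ)) * poissonWeight k m x

/-- `m_min = min_j m_j`. -/
def mMin {d : ℕ} [NeZero d] (m : Fin d → ℕ) : ℕ :=
  Finset.univ.inf' Finset.univ_nonempty m

end SzaszMirakyan

end

open SzaszMirakyan

/-! For x in the open orthant let the K_j be independent Poisson variables of rates m_j x_j and put
T = K/m. The weights of the estimator are the law of K, so the estimator is the sample mean of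
G(X_i), where G(y) = P(y ≤ T) (`estimator_eq_sum_upperProb`). By Fubini, E G(X) = E F(T). Since
G(y)² is the probability that two independent copies T, T' both dominate y, E G(X)² = E F(T ∧ T').
Hence the bias is E F(T) - F(x), and the variance is n⁻¹ (E F(T ∧ T') - (E F(T))²) for every n ≥ 1.

Both expectations are expanded by Taylor's formula at x. Because F takes values in [0,1], the
remainder is at most ε|h|² + C|h|⁴ for every displacement h, uniformly for x in S
(`exists_abs_taylor_two_le`); second and fourth Poisson moments then suffice, with no separate tail
estimate.

Bias: T - x is centred with uncorrelated coordinates of variance x_j/m_j, so the linear term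
vanishes and only the diagonal of the Hessian survives.

Variance: min(a,b) = (a + b - |a - b|)/2, so the linear term at T ∧ T' has mean -∑ ∂_j F(x) E|K_j -
K_j'| / (2 m_j), everything else being O(1/m_min). It remains to know that E|K - K'| ~ 2√(r/π) for
two independent Poisson variables of rate r. The difference divided by √r converges weakly to
N(0,2), by characteristic functions, and its second moments are bounded, so first absolute moments
converge (`tendsto_integral_abs_sub_poissonMeasure`). On S the coordinates are bounded away from
zero, so all rates m_j x_j tend to infinity uniformly. Finally (E F(T))² differs from F(x)² by
O(1/m_min), which is o(m_min^{-1/2}). -/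

open Filter Topology
open scoped NNReal Nat

namespace SzaszMirakyan

/-! ### Moments of the Poisson distribution -/

lemma poisson_weight_succ (r : ℝ≥0) (n : ℕ) :
    Real.exp (-r) * (r : ℝ) ^ (n + 1) / ((n + 1)! : ℕ) * ((n + 1 : ℕ) : ℝ) =
      r * (Real.exp (-r) * (r : ℝ) ^ n / (n ! : ℕ)) := by
  rw [Nat.factorial_succ]
  have h1 : ((n ! : ℕ) : ℝ) ≠ 0 := by positivity
  have h2 : ((n : ℝ) + 1) ≠ 0 := by positivity
  push_cast
  field_simp
  ring

/-- The Stein identity of the Poisson distribution. -/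
lemma integral_natCast_mul_poissonMeasure (r : ℝ≥0) (f : ℕ → ℝ) :
    ∫ n, (n : ℝ) * f n ∂(poissonMeasure r) = r * ∫ n, f (n + 1) ∂(poissonMeasure r) := by
  rw [integral_poissonMeasure, integral_poissonMeasure, ← tsum_mul_left,
    ← Function.Injective.tsum_eq (Nat.succ_injective)]
  · refine tsum_congr fun n => ?_
    have := poisson_weight_succ r n
    simp only [smul_eq_mul, Nat.succ_eq_add_one]
    rw [← mul_assoc, this, mul_assoc]
  · intro n hn
    cases n with
    | zero => simp at hn
    | succ n => exact ⟨n, rfl⟩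

lemma integrable_natCast_mul_poissonMeasure (r : ℝ≥0) {f : ℕ → ℝ}
    (hf : Integrable (fun n => f (n + 1)) (poissonMeasure r)) :
    Integrable (fun n : ℕ => (n : ℝ) * f n) (poissonMeasure r) := by
  rw [integrable_poissonMeasure_iff] at hf ⊢
  rw [← Function.Injective.summable_iff (Nat.succ_injective)]
  · refine (hf.mul_left (r : ℝ)).congr fun n => ?_
    have := poisson_weight_succ r n
    simp only [Function.comp, Nat.succ_eq_add_one, norm_mul]
    rw [← mul_assoc, ← mul_assoc, ← this]
    rw [Real.norm_natCast]
  · intro n hn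
    cases n with
    | zero => simp
    | succ n => exact absurd ⟨n, rfl⟩ hn

/-- The Stein shift trades n^(k+1) for (n+1)^k, whose binomial expansion involves only powers up to
k; hence strong induction. -/
lemma integrable_pow_poissonMeasure (r : ℝ≥0) (k : ℕ) :
    Integrable (fun n : ℕ => (n : ℝ) ^ k) (poissonMeasure r) := by
  induction k using Nat.strong_induction_on with
  | _ k ih =>
    cases k with
    | zero => simp
    | succ k =>
      simp_rw [pow_succ']
      refine integrable_natCast_mul_poissonMeasure r (f := fun n => (n : ℝ) ^ k) ?_
      simp_rw [Nat.cast_add, Nat.cast_one, add_pow, one_pow, mul_one]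
      refine integrable_finsetSum _ fun i hi => (ih i ?_).mul_const _
      simpa using hi

lemma integral_id_poissonMeasure (r : ℝ≥0) : ∫ n, (n : ℝ) ∂(poissonMeasure r) = r := by
  simpa using integral_natCast_mul_poissonMeasure r (fun _ => 1)

lemma integral_sq_poissonMeasure (r : ℝ≥0) :
    ∫ n, (n : ℝ) ^ 2 ∂(poissonMeasure r) = (r : ℝ) ^ 2 + r := by
  have h := integral_natCast_mul_poissonMeasure r (fun n => n)
  have i1 := integrable_pow_poissonMeasure r 1
  simp only [pow_one] at i1
  simp_rw [sq]
  rw [h]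
  push_cast
  rw [integral_add i1 (integrable_const _), integral_id_poissonMeasure]
  simp
  ring

lemma integral_pow_three_poissonMeasure (r : ℝ≥0) :
    ∫ n, (n : ℝ) ^ 3 ∂(poissonMeasure r) = (r : ℝ) ^ 3 + 3 * r ^ 2 + r := by
  have h := integral_natCast_mul_poissonMeasure r (fun n => (n : ℝ) ^ 2)
  have i1 := integrable_pow_poissonMeasure r 1
  have i2 := integrable_pow_poissonMeasure r 2
  simp only [pow_one] at i1
  simp_rw [pow_succ' _ 2]
  rw [h]
  have e : ∀ n : ℕ, (((n + 1 : ℕ) : ℝ)) ^ 2 = (n : ℝ) ^ 2 + (2 * n + 1) := fun n => by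
    push_cast; ring
  simp_rw [e]
  rw [integral_add i2 (by fun_prop), integral_add (by fun_prop) (by fun_prop),
    integral_const_mul, integral_id_poissonMeasure, integral_sq_poissonMeasure]
  simp
  ring

lemma integral_pow_four_poissonMeasure (r : ℝ≥0) :
    ∫ n, (n : ℝ) ^ 4 ∂(poissonMeasure r) = (r : ℝ) ^ 4 + 6 * r ^ 3 + 7 * r ^ 2 + r := by
  have h := integral_natCast_mul_poissonMeasure r (fun n => (n : ℝ) ^ 3)
  have i1 := integrable_pow_poissonMeasure r 1
  have i2 := integrable_pow_poissonMeasure r 2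
  have i3 := integrable_pow_poissonMeasure r 3
  simp only [pow_one] at i1
  simp_rw [pow_succ' _ 3]
  rw [h]
  have e : ∀ n : ℕ, (((n + 1 : ℕ) : ℝ)) ^ 3 = (n : ℝ) ^ 3 + (3 * (n : ℝ) ^ 2 + (3 * n + 1)) :=
    fun n => by push_cast; ring
  simp_rw [e]
  rw [integral_add i3 (by fun_prop), integral_add (by fun_prop) (by fun_prop),
    integral_add (by fun_prop) (by fun_prop),
    integral_const_mul, integral_const_mul, integral_id_poissonMeasure,
    integral_sq_poissonMeasure, integral_pow_three_poissonMeasure]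
  simp
  ring

lemma integrable_sub_pow_poissonMeasure (r : ℝ≥0) (a : ℝ) (k : ℕ) :
    Integrable (fun n : ℕ => ((n : ℝ) - a) ^ k) (poissonMeasure r) := by
  simp_rw [sub_eq_add_neg, add_pow]
  exact integrable_finsetSum _ fun i _ =>
    ((integrable_pow_poissonMeasure r i).mul_const _).mul_const _

lemma integral_sub_poissonMeasure (r : ℝ≥0) :
    ∫ n, ((n : ℝ) - r) ∂(poissonMeasure r) = 0 := by
  have i1 := integrable_pow_poissonMeasure r 1
  simp only [pow_one] at i1
  rw [integral_sub i1 (by fun_prop), integral_id_poissonMeasure]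
  simp

lemma integral_sub_sq_poissonMeasure (r : ℝ≥0) :
    ∫ n, ((n : ℝ) - r) ^ 2 ∂(poissonMeasure r) = r := by
  have i1 := integrable_pow_poissonMeasure r 1
  have i2 := integrable_pow_poissonMeasure r 2
  simp only [pow_one] at i1
  have e : ∀ n : ℕ, ((n : ℝ) - r) ^ 2 = (n : ℝ) ^ 2 + ((-2 * r) * n + r ^ 2) := fun n => by ring
  simp_rw [e]
  rw [integral_add i2 (by fun_prop), integral_add (by fun_prop) (by fun_prop),
    integral_const_mul, integral_id_poissonMeasure, integral_sq_poissonMeasure]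
  simp
  ring

lemma integral_sub_pow_four_poissonMeasure (r : ℝ≥0) :
    ∫ n, ((n : ℝ) - r) ^ 4 ∂(poissonMeasure r) = 3 * (r : ℝ) ^ 2 + r := by
  have i1 := integrable_pow_poissonMeasure r 1
  have i2 := integrable_pow_poissonMeasure r 2
  have i3 := integrable_pow_poissonMeasure r 3
  have i4 := integrable_pow_poissonMeasure r 4
  simp only [pow_one] at i1
  have e : ∀ n : ℕ, ((n : ℝ) - r) ^ 4 = (n : ℝ) ^ 4 + ((-4 * r) * (n : ℝ) ^ 3 +
      ((6 * r ^ 2) * (n : ℝ) ^ 2 + ((-4 * r ^ 3) * n + r ^ 4))) := fun n => by ring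
  simp_rw [e]
  rw [integral_add i4 (by fun_prop), integral_add (by fun_prop) (by fun_prop),
    integral_add (by fun_prop) (by fun_prop), integral_add (by fun_prop) (by fun_prop),
    integral_const_mul, integral_const_mul, integral_const_mul, integral_id_poissonMeasure,
    integral_sq_poissonMeasure, integral_pow_three_poissonMeasure,
    integral_pow_four_poissonMeasure]
  simp
  ring


/-! ### The mean absolute difference of two independent Poisson variables -/

/-- Truncation at height A changes |x| only where |x| > A, and there |x| - A ≤ x²/A. -/
lemma abs_integral_abs_sub_integral_min_le {μ : Measure ℝ} [IsProbabilityMeasure μ]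
    (h2 : Integrable (fun x => x ^ 2) μ) {A : ℝ} (hA : 0 < A) :
    |∫ x, |x| ∂μ - ∫ x, min |x| A ∂μ| ≤ (∫ x, x ^ 2 ∂μ) / A := by
  have h1 : Integrable (fun x : ℝ => |x|) μ := by
    refine (h2.add (integrable_const 1)).mono' (by fun_prop) (ae_of_all _ fun x => ?_)
    simp only [Real.norm_eq_abs, abs_abs, Pi.add_apply]
    nlinarith [sq_abs x, sq_nonneg (|x| - 1), sq_nonneg x]
  have hm : Integrable (fun x : ℝ => min |x| A) μ := by
    refine h1.mono' (by fun_prop) (ae_of_all _ fun x => ?_)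
    rw [Real.norm_eq_abs, abs_of_nonneg (by positivity)]
    exact min_le_left _ _
  rw [← integral_sub h1 hm, ← integral_div]
  refine (abs_integral_le_integral_abs).trans (integral_mono_of_nonneg (ae_of_all _ fun x =>
    abs_nonneg _) (h2.div_const A) (ae_of_all _ fun x => ?_))
  simp only
  rw [le_div_iff₀ hA]
  rcases le_total |x| A with h | h
  · rw [min_eq_left h]; simp; positivity
  · rw [min_eq_right h, abs_of_nonneg (by linarith)]
    nlinarith [sq_abs x, sq_nonneg (|x| - A), sq_nonneg A]

/-- Weak convergence together with bounded second moments gives convergence of the first absolute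
moments. -/
lemma tendsto_integral_abs_of_tendsto {μ : ℕ → ProbabilityMeasure ℝ} {μ₀ : ProbabilityMeasure ℝ}
    (h : Tendsto μ atTop (𝓝 μ₀)) {C : ℝ}
    (hi : ∀ n, Integrable (fun x => x ^ 2) (μ n : Measure ℝ))
    (hC : ∀ n, ∫ x, x ^ 2 ∂(μ n : Measure ℝ) ≤ C)
    (hi₀ : Integrable (fun x => x ^ 2) (μ₀ : Measure ℝ))
    (hC₀ : ∫ x, x ^ 2 ∂(μ₀ : Measure ℝ) ≤ C) :
    Tendsto (fun n => ∫ x, |x| ∂(μ n : Measure ℝ)) atTop (𝓝 (∫ x, |x| ∂(μ₀ : Measure ℝ))) := by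
  rw [Metric.tendsto_atTop]
  intro ε hε
  have hC0 : 0 ≤ C := (integral_nonneg fun x => sq_nonneg x).trans hC₀
  -- This height makes each of the two truncation errors less than ε/3; `C + 1` keeps `A` positive
  -- when `C = 0`.
  set A : ℝ := 3 * (C + 1) / ε with hA_def
  have hA : 0 < A := by positivity
  have hCA : C / A < ε / 3 := by
    rw [div_lt_iff₀ hA, hA_def]
    field_simp
    linarith
  rw [ProbabilityMeasure.tendsto_iff_forall_integral_tendsto] at h
  let f : BoundedContinuousFunction ℝ ℝ :=
    BoundedContinuousFunction.ofNormedAddCommGroup (fun x => min |x| A) (by fun_prop) A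
      (fun x => by
        rw [Real.norm_eq_abs, abs_of_nonneg (le_min (abs_nonneg _) hA.le)]
        exact min_le_right _ _)
  obtain ⟨N, hN⟩ := Metric.tendsto_atTop.1 (h f) (ε / 3) (by positivity)
  refine ⟨N, fun n hn => ?_⟩
  have h1 := hN n hn
  have h2 := abs_integral_abs_sub_integral_min_le (hi n) hA
  have h3 := abs_integral_abs_sub_integral_min_le hi₀ hA
  have h4 := div_le_div_of_nonneg_right (hC n) hA.le
  have h5 := div_le_div_of_nonneg_right hC₀ hA.le
  change dist (∫ x, min |x| A ∂(μ n : Measure ℝ)) (∫ x, min |x| A ∂(μ₀ : Measure ℝ)) < _ at h1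
  rw [Real.dist_eq, abs_lt] at *
  rw [abs_le] at h2 h3
  constructor <;> linarith [h2.1, h2.2, h3.1, h3.2, h1.1, h1.2]

/-- The variance is 2 because the limit is that of a difference of two independent standardised
variables. The integrand is even, which reduces the computation to a Gamma integral on the
half-line. -/
lemma integral_abs_gaussianReal_two : ∫ x, |x| ∂(gaussianReal 0 2) = 2 / √Real.pi := by
  rw [integral_gaussianReal_eq_integral_smul (by norm_num)]
  have e : ∀ x : ℝ, gaussianPDFReal 0 2 x • |x| =
      (fun y : ℝ => (√(2 * Real.pi * 2))⁻¹ * (y ^ (1 : ℝ) * Real.exp (-(1 / 4) * y ^ (2 : ℝ)))) |x| := by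
    intro x
    simp only [gaussianPDFReal, smul_eq_mul, Real.rpow_one, Real.rpow_two, sq_abs]
    rw [mul_comm |x|, mul_assoc]
    congr 3
    push_cast
    ring_nf
  simp_rw [e]
  rw [integral_comp_abs (f := fun y : ℝ =>
      (√(2 * Real.pi * 2))⁻¹ * (y ^ (1 : ℝ) * Real.exp (-(1 / 4) * y ^ (2 : ℝ)))),
    integral_const_mul,
    integral_rpow_mul_exp_neg_mul_rpow (by norm_num) (by norm_num) (by norm_num)]
  have h4 : √(2 * Real.pi * 2) = 2 * √Real.pi := by
    rw [show 2 * Real.pi * 2 = 2 ^ 2 * Real.pi by ring, Real.sqrt_mul (by norm_num),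
      Real.sqrt_sq (by norm_num)]
  rw [h4]
  have : √Real.pi ≠ 0 := by positivity
  norm_num [Real.rpow_neg_one]
  field_simp

/-- The law of the standardised difference of two independent Poisson variables. -/
noncomputable def poissonDiff (r : ℝ≥0) : Measure ℝ :=
  ((poissonMeasure r).prod (poissonMeasure r)).map
    (fun p : ℕ × ℕ => (√(r : ℝ))⁻¹ * ((p.1 : ℝ) - p.2))

instance (r : ℝ≥0) : IsProbabilityMeasure (poissonDiff r) :=
  Measure.isProbabilityMeasure_map .of_discrete

/-- By independence the exponents r(e^{is} - 1) and r(e^{-is} - 1), with s = t/√r, add up to -2r(1 -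
cos s). -/
lemma charFun_poissonDiff (r : ℝ≥0) (t : ℝ) :
    charFun (poissonDiff r) t =
      Complex.exp ((-(2 * r * (1 - Real.cos ((√(r : ℝ))⁻¹ * t))) : ℝ) : ℂ) := by
  rw [charFun_apply, poissonDiff, integral_map .of_discrete (by fun_prop)]
  set s : ℝ := (√(r : ℝ))⁻¹ * t with hs
  have h1 := charFun_map_cast_poissonMeasure r s
  have h2 := charFun_map_cast_poissonMeasure r (-s)
  rw [charFun_apply, integral_map .of_discrete (by fun_prop)] at h1 h2
  have e : ∀ p : ℕ × ℕ, Complex.exp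
      (((inner ℝ ((√(r : ℝ))⁻¹ * ((p.1 : ℝ) - p.2)) t : ℝ) : ℂ) * Complex.I) =
      Complex.exp (((inner ℝ (p.1 : ℝ) s : ℝ) : ℂ) * Complex.I) *
      Complex.exp (((inner ℝ (p.2 : ℝ) (-s) : ℝ) : ℂ) * Complex.I) := by
    intro p
    rw [← Complex.exp_add]
    simp only [Real.inner_apply, hs]
    push_cast
    ring_nf
  simp_rw [e]
  rw [integral_prod_mul (μ := poissonMeasure r) (ν := poissonMeasure r)
    (fun a : ℕ => Complex.exp (((inner ℝ (a : ℝ) s : ℝ) : ℂ) * Complex.I))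
    (fun a : ℕ => Complex.exp (((inner ℝ (a : ℝ) (-s) : ℝ) : ℂ) * Complex.I)), h1, h2,
    ← Complex.exp_add]
  congr 1
  push_cast
  rw [Complex.cos]
  ring_nf

lemma tendsto_mul_one_sub_cos (t : ℝ) :
    Tendsto (fun r : ℝ≥0 => 2 * (r : ℝ) * (1 - Real.cos ((√(r : ℝ))⁻¹ * t))) atTop
      (𝓝 (t ^ 2)) := by
  have h0 : Tendsto (fun r : ℝ≥0 => t ^ 4 * (r : ℝ)⁻¹) atTop (𝓝 0) := by
    simpa using (tendsto_inv_atTop_zero.comp (NNReal.tendsto_coe_atTop.2 tendsto_id)).const_mul (t ^ 4)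
  refine tendsto_of_tendsto_of_dist tendsto_const_nhds
    (squeeze_zero' (Eventually.of_forall fun _ => dist_nonneg) ?_ h0)
  -- With s = t/√r, r ≥ t² gives |s| ≤ 1, as the fourth-order cosine bound requires. The error is
  -- then at most r s⁴ = t⁴/r.
  filter_upwards [eventually_ge_atTop (max 1 (Real.toNNReal (t ^ 2)))] with r hr
  have hr1 : (1 : ℝ) ≤ r := by exact_mod_cast (le_max_left _ _).trans hr
  have hr2 : t ^ 2 ≤ r := by
    have := (le_max_right _ _).trans hr
    exact (Real.toNNReal_le_iff_le_coe).1 this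
  set s : ℝ := (√(r : ℝ))⁻¹ * t with hs
  have hs2 : s ^ 2 * r = t ^ 2 := by
    rw [hs, mul_pow, inv_pow, Real.sq_sqrt (by positivity)]
    field_simp
  have hs1 : |s| ≤ 1 := by
    rw [← sq_le_one_iff_abs_le_one]
    by_contra! h
    nlinarith
  have hb := Real.cos_bound hs1
  rw [show |s| ^ 4 = s ^ 4 by rw [← abs_pow, abs_of_nonneg (by positivity)]] at hb
  have e1 : s ^ 4 * r = t ^ 4 * (r : ℝ)⁻¹ := by
    rw [show t ^ 4 = (t ^ 2) ^ 2 by ring, ← hs2]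
    field_simp
  rw [Real.dist_eq, ← hs2, ← e1]
  rw [show s ^ 2 * (r : ℝ) - 2 * r * (1 - Real.cos s) =
    2 * r * (Real.cos s - (1 - s ^ 2 / 2)) by ring, abs_mul, abs_of_nonneg (by positivity)]
  have : (0 : ℝ) ≤ s ^ 4 := by positivity
  nlinarith

lemma tendsto_charFun_poissonDiff (t : ℝ) :
    Tendsto (fun r : ℝ≥0 => charFun (poissonDiff r) t) atTop
      (𝓝 (charFun (gaussianReal 0 2) t)) := by
  simp_rw [charFun_poissonDiff, charFun_gaussianReal]
  have h := ((Complex.continuous_ofReal.tendsto _).comp (tendsto_mul_one_sub_cos t).neg).cexp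
  refine h.congr' (Eventually.of_forall fun _ => rfl) |>.trans_eq ?_
  congr 2
  push_cast
  ring

lemma integrable_sub_pow_prod_poissonMeasure (r : ℝ≥0) (k : ℕ) :
    Integrable (fun p : ℕ × ℕ => ((p.1 : ℝ) - p.2) ^ k)
      ((poissonMeasure r).prod (poissonMeasure r)) := by
  simp_rw [sub_eq_add_neg, add_pow]
  refine integrable_finsetSum _ fun i _ => Integrable.mul_const ?_ _
  simp_rw [neg_pow ((_ : ℕ) : ℝ)]
  exact (integrable_pow_poissonMeasure r i).mul_prod
    ((integrable_pow_poissonMeasure r (k - i)).const_mul _)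

lemma integral_sub_sq_prod_poissonMeasure (r : ℝ≥0) :
    ∫ p : ℕ × ℕ, ((p.1 : ℝ) - p.2) ^ 2 ∂((poissonMeasure r).prod (poissonMeasure r)) = 2 * r := by
  rw [integral_prod _ (integrable_sub_pow_prod_poissonMeasure r 2)]
  have i1 := integrable_pow_poissonMeasure r 1
  have i2 := integrable_pow_poissonMeasure r 2
  simp only [pow_one] at i1
  have e : ∀ x y : ℕ, ((x : ℝ) - y) ^ 2 = (x : ℝ) ^ 2 + ((-2 * x) * (y : ℝ) + (y : ℝ) ^ 2) :=
    fun x y => by ring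
  have h : ∀ x : ℕ, ∫ y : ℕ, ((x : ℝ) - y) ^ 2 ∂(poissonMeasure r) =
      (x : ℝ) ^ 2 + ((-2 * r) * x + (r ^ 2 + r)) := by
    intro x
    simp_rw [e]
    rw [integral_add (by fun_prop) (by fun_prop), integral_add (by fun_prop) i2,
      integral_const_mul, integral_id_poissonMeasure, integral_sq_poissonMeasure]
    simp
    ring
  simp_rw [h]
  rw [integral_add i2 (by fun_prop), integral_add (by fun_prop) (by fun_prop),
      integral_const_mul, integral_id_poissonMeasure, integral_sq_poissonMeasure]
  simp
  ring

lemma integrable_sq_poissonDiff (r : ℝ≥0) : Integrable (fun x => x ^ 2) (poissonDiff r) := by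
  rw [poissonDiff, integrable_map_measure (by fun_prop) .of_discrete]
  refine ((integrable_sub_pow_prod_poissonMeasure r 2).const_mul ((√(r : ℝ))⁻¹ ^ 2)).congr
    (ae_of_all _ fun p => ?_)
  simp [mul_pow]

lemma integral_sq_poissonDiff_le (r : ℝ≥0) : ∫ x, x ^ 2 ∂(poissonDiff r) ≤ 2 := by
  rw [poissonDiff, integral_map .of_discrete (by fun_prop)]
  simp_rw [mul_pow]
  rw [integral_const_mul, integral_sub_sq_prod_poissonMeasure, inv_pow, Real.sq_sqrt r.coe_nonneg]
  rcases eq_or_ne (r : ℝ) 0 with h | h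
  · simp [h]
  · apply le_of_eq; field_simp

/-- The mean absolute difference of two independent Poisson variables of rate `r` is asymptotic
to `2 √(r / π)`. -/
lemma tendsto_integral_abs_sub_poissonMeasure :
    Tendsto (fun r : ℝ≥0 => (√(r : ℝ))⁻¹ *
      ∫ p : ℕ × ℕ, |(p.1 : ℝ) - p.2| ∂((poissonMeasure r).prod (poissonMeasure r))) atTop
      (𝓝 (2 / √Real.pi)) := by
  have e : ∀ r : ℝ≥0, (√(r : ℝ))⁻¹ *
      ∫ p : ℕ × ℕ, |(p.1 : ℝ) - p.2| ∂((poissonMeasure r).prod (poissonMeasure r)) =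
      ∫ x, |x| ∂(poissonDiff r) := by
    intro r
    rw [poissonDiff, integral_map .of_discrete (by fun_prop)]
    simp_rw [abs_mul]
    rw [integral_const_mul, abs_of_nonneg (by positivity)]
  simp_rw [e]
  -- The weak convergence argument is stated along sequences, so the limit in `r` is tested on
  -- sequences of rates.
  refine tendsto_of_seq_tendsto fun u hu => ?_
  rw [← integral_abs_gaussianReal_two]
  have hg : Integrable (fun x : ℝ => x ^ 2) (gaussianReal 0 2) :=
    (memLp_id_gaussianReal (μ := 0) (v := 2) 2).integrable_sq
  have hv : ∫ x, x ^ 2 ∂(gaussianReal 0 2) ≤ 2 := by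
    have h := variance_fun_id_gaussianReal (μ := 0) (v := 2)
    rw [variance_of_integral_eq_zero (by fun_prop) (by simp)] at h
    rw [h]; norm_num
  refine tendsto_integral_abs_of_tendsto (μ := fun n => (⟨poissonDiff (u n), inferInstance⟩ : ProbabilityMeasure ℝ))
    (μ₀ := (⟨gaussianReal 0 2, inferInstance⟩ : ProbabilityMeasure ℝ)) (C := 2) ?_ (fun n => integrable_sq_poissonDiff _)
    (fun n => integral_sq_poissonDiff_le _) hg hv
  refine ProbabilityMeasure.tendsto_iff_tendsto_charFun.2 ?_
  exact fun t => (tendsto_charFun_poissonDiff t).comp hu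


/-! ### Taylor's formula of order two, uniformly on compact sets -/

section Taylor

variable {E : Type*} [NormedAddCommGroup E] [NormedSpace ℝ E]

/-- The mean value inequality is applied twice on the ball: to the derivative minus its
linearisation, then to `F` minus its quadratic polynomial. This loses a factor 1/2 in the constant,
which is immaterial. -/
lemma abs_taylor_two_le {F : E → ℝ} {U : Set E} (hU : IsOpen U) (hF : ContDiffOn ℝ 2 F U)
    {x y : E} {ε : ℝ} (hsub : Metric.closedBall x ‖y - x‖ ⊆ U)
    (hε : ∀ z ∈ Metric.closedBall x ‖y - x‖,
      ‖fderiv ℝ (fderiv ℝ F) z - fderiv ℝ (fderiv ℝ F) x‖ ≤ ε) :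
    |F y - F x - fderiv ℝ F x (y - x) - (1 / 2) * fderiv ℝ (fderiv ℝ F) x (y - x) (y - x)| ≤
      ε * ‖y - x‖ ^ 2 := by
  set r := ‖y - x‖ with hr
  have hx : x ∈ Metric.closedBall x r := Metric.mem_closedBall_self (norm_nonneg _)
  have hy : y ∈ Metric.closedBall x r := by rw [Metric.mem_closedBall, dist_eq_norm]
  have hconv := convex_closedBall x r
  have hat : ∀ z ∈ U, ContDiffAt ℝ 2 F z := fun z hz => hF.contDiffAt (hU.mem_nhds hz)
  have h1 : ∀ z ∈ U, HasFDerivAt F (fderiv ℝ F z) z := fun z hz =>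
    ((hat z hz).differentiableAt (by norm_num)).hasFDerivAt
  have h2 : ∀ z ∈ U, HasFDerivAt (fderiv ℝ F) (fderiv ℝ (fderiv ℝ F) z) z := fun z hz =>
    (((hat z hz).fderiv_right (m := 1) (by norm_num)).differentiableAt (by norm_num)).hasFDerivAt
  have hε0 : 0 ≤ ε := (ContinuousLinearMap.opNorm_nonneg _).trans (hε x hx)
  set B := fderiv ℝ (fderiv ℝ F) x with hB
  have hsymm : ∀ v w, B v w = B w v :=
    (hat x (hsub hx)).isSymmSndFDerivAt (by simp)
  have hd : ∀ z ∈ Metric.closedBall x r, ‖fderiv ℝ F z - fderiv ℝ F x - B (z - x)‖ ≤ ε * r := by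
    intro z hz
    have key := hconv.norm_image_sub_le_of_norm_hasFDerivWithin_le
      (f := fun z => fderiv ℝ F z - B z) (C := ε)
      (fun w hw => ((h2 w (hsub hw)).sub B.hasFDerivAt).hasFDerivWithinAt) hε hx hz
    rw [map_sub]
    calc _ = ‖fderiv ℝ F z - B z - (fderiv ℝ F x - B x)‖ := by congr 1; abel
      _ ≤ ε * ‖z - x‖ := key
      _ ≤ ε * r := by
        refine mul_le_mul_of_nonneg_left ?_ hε0
        rwa [← dist_eq_norm]
  -- Symmetry of the second derivative merges the two terms of the product rule and cancels the
  -- factor 1/2.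
  have hq : ∀ z, HasFDerivAt (fun z => (1 / 2 : ℝ) * B (z - x) (z - x)) (B (z - x)) z := by
    intro z
    have hs : HasFDerivAt (fun z : E => z - x) (ContinuousLinearMap.id ℝ E) z :=
      (hasFDerivAt_id z).sub_const x
    have hBs : HasFDerivAt (fun z : E => B (z - x)) (B.comp (ContinuousLinearMap.id ℝ E)) z :=
      B.hasFDerivAt.comp z hs
    refine ((hBs.clm_apply hs).const_mul (1 / 2 : ℝ)).congr_fderiv ?_
    ext v
    simp
    rw [← map_sub, hsymm v (z - x), map_sub, sub_apply]
    ring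
  have key := hconv.norm_image_sub_le_of_norm_hasFDerivWithin_le
      (f := fun z => F z - fderiv ℝ F x z - (1 / 2 : ℝ) * B (z - x) (z - x)) (C := ε * r)
      (fun w hw => (((h1 w (hsub hw)).sub (fderiv ℝ F x).hasFDerivAt).sub
        (hq w)).hasFDerivWithinAt) hd hx hy
  simp only [sub_self, map_zero, mul_zero, Real.norm_eq_abs, ← hr] at key
  rw [map_sub]
  calc _ = _ := by congr 1; ring
    _ ≤ _ := key
    _ = _ := by ring

/-- Only `x` is confined to the compact set; `z` may leave it. This is why continuity is assumed at
the points of `S` in the ambient space. -/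
lemma exists_forall_norm_sub_le_of_isCompact {E G : Type*} [SeminormedAddCommGroup E]
    [SeminormedAddCommGroup G] {f : E → G}
    {S : Set E} (hS : IsCompact S) (hf : ∀ x ∈ S, ContinuousAt f x) {ε : ℝ} (hε : 0 < ε) :
    ∃ δ > 0, ∀ x ∈ S, ∀ z, dist z x < δ → ‖f z - f x‖ ≤ ε := by
  have huc := hS.uniformContinuousAt_of_continuousAt f hf (Metric.dist_mem_uniformity hε)
  obtain ⟨δ, hδ, huc⟩ := Metric.mem_uniformity_dist.1 huc
  refine ⟨δ, hδ, fun x hx z hz => ?_⟩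
  have h := huc (a := x) (b := z) (by rwa [dist_comm]) hx
  rw [← dist_eq_norm, dist_comm]
  exact le_of_lt h

/-- Taylor's formula of order two at the points of a compact set: a remainder that is bounded
globally and, near the compact set, small in comparison with `‖y - x‖ ^ 2`. -/
lemma exists_abs_taylor_two_le {F : E → ℝ} {U : Set E} (hU : IsOpen U)
    (hF : ContDiffOn ℝ 2 F U) (hosc : ∀ x y, |F y - F x| ≤ 1) {S : Set E} (hS : IsCompact S)
    (hSU : S ⊆ U) {ε : ℝ} (hε : 0 < ε) :
    ∃ C : ℝ, 0 ≤ C ∧ ∀ x ∈ S, ∀ y,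
      |F y - F x - fderiv ℝ F x (y - x) - (1 / 2) * fderiv ℝ (fderiv ℝ F) x (y - x) (y - x)| ≤
        ε * ‖y - x‖ ^ 2 + C * ‖y - x‖ ^ 4 := by
  have hat : ∀ z ∈ U, ContDiffAt ℝ 2 F z := fun z hz => hF.contDiffAt (hU.mem_nhds hz)
  have hc1 : ∀ z ∈ U, ContinuousAt (fderiv ℝ F) z := fun z hz =>
    ((hat z hz).fderiv_right (m := 1) (by norm_num)).continuousAt
  have hc2 : ∀ z ∈ U, ContinuousAt (fderiv ℝ (fderiv ℝ F)) z := fun z hz =>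
    (((hat z hz).fderiv_right (m := 1) (by norm_num)).fderiv_right (m := 0)
      (by norm_num)).continuousAt
  obtain ⟨δ₁, hδ₁, hthick⟩ := hS.exists_thickening_subset_open hU hSU
  obtain ⟨δ₂, hδ₂, huc⟩ := exists_forall_norm_sub_le_of_isCompact
    (G := E →L[ℝ] E →L[ℝ] ℝ) hS
    (fun a ha => hc2 a (hSU ha)) hε
  obtain ⟨C₁, hC₁⟩ := hS.exists_bound_of_continuousOn
    (f := fderiv ℝ F) fun a ha => (hc1 a (hSU ha)).continuousWithinAt
  obtain ⟨C₂, hC₂⟩ := hS.exists_bound_of_continuousOn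
    (f := fderiv ℝ (fderiv ℝ F)) fun a ha => (hc2 a (hSU ha)).continuousWithinAt
  set δ := min δ₁ δ₂ with hδ_def
  have hδ : 0 < δ := lt_min hδ₁ hδ₂
  -- The three summands absorb, when ‖y - x‖ ≥ δ, the increment of `F`, the linear term and the
  -- quadratic term: each is multiplied by the power of ‖y - x‖/δ ≥ 1 that makes it of order four.
  refine ⟨1 / δ ^ 4 + |C₁| / δ ^ 3 + |C₂| / δ ^ 2, by positivity, fun x hx y => ?_⟩
  rcases lt_or_ge ‖y - x‖ δ with h | h
  · have hball : ∀ z ∈ Metric.closedBall x ‖y - x‖, dist z x < δ := fun z hz =>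
      (Metric.mem_closedBall.1 hz).trans_lt h
    refine (abs_taylor_two_le hU hF (ε := ε) (fun z hz => hthick ?_) fun z hz => ?_).trans ?_
    · exact Metric.mem_thickening_iff.2 ⟨x, hx, (hball z hz).trans_le (min_le_left _ _)⟩
    · exact huc x hx z ((hball z hz).trans_le (min_le_right _ _))
    · have : 0 ≤ (1 / δ ^ 4 + |C₁| / δ ^ 3 + |C₂| / δ ^ 2) * ‖y - x‖ ^ 4 := by positivity
      linarith
  · set r := ‖y - x‖ with hr
    have hr0 : 0 < r := hδ.trans_le h
    have e1 : |fderiv ℝ F x (y - x)| ≤ |C₁| * r := by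
      refine ((fderiv ℝ F x).le_opNorm _).trans ?_
      gcongr
      exact (hC₁ x hx).trans (le_abs_self _)
    have e2 : |fderiv ℝ (fderiv ℝ F) x (y - x) (y - x)| ≤ |C₂| * r ^ 2 := by
      refine ((fderiv ℝ (fderiv ℝ F) x).le_opNorm₂ _ _).trans ?_
      rw [sq, ← mul_assoc]
      gcongr
      exact (hC₂ x hx).trans (le_abs_self _)
    have e0 := hosc x y
    have q : 1 ≤ r / δ := (one_le_div hδ).2 h
    have q1 : 1 ≤ (r / δ) ^ 4 := one_le_pow₀ q
    have q2 : |C₁| * r ≤ |C₁| * r * (r / δ) ^ 3 :=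
      le_mul_of_one_le_right (by positivity) (one_le_pow₀ q)
    have q3 : |C₂| * r ^ 2 ≤ |C₂| * r ^ 2 * (r / δ) ^ 2 :=
      le_mul_of_one_le_right (by positivity) (one_le_pow₀ q)
    have e3 : (1 / δ ^ 4 + |C₁| / δ ^ 3 + |C₂| / δ ^ 2) * r ^ 4 =
        (r / δ) ^ 4 + |C₁| * r * (r / δ) ^ 3 + |C₂| * r ^ 2 * (r / δ) ^ 2 := by
      field_simp
    rw [e3]
    have q4 : 0 ≤ ε * r ^ 2 := by positivity
    have q5 : 0 ≤ |C₂| * r ^ 2 := by positivity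
    rw [abs_le] at *
    constructor <;> linarith [e0.1, e0.2, e1.1, e1.2, e2.1, e2.2]

end Taylor

/-! ### Fréchet derivatives in coordinates -/

lemma isOpen_interiorOrthant (d : ℕ) : IsOpen (interiorOrthant d) := by
  simp only [interiorOrthant, Set.ofPred_forall]
  exact isOpen_iInter_of_finite fun j => isOpen_lt continuous_const (continuous_apply j)

section Partial

variable {d : ℕ} {F : (Fin d → ℝ) → ℝ} {U : Set (Fin d → ℝ)}

lemma partialDeriv_eq_fderiv (hU : IsOpen U) (hF : ContDiffOn ℝ 2 F U) {x : Fin d → ℝ}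
    (hx : x ∈ U) (i : Fin d) : partialDeriv i F x = fderiv ℝ F x (Pi.single i 1) :=
  ((hF.contDiffAt (hU.mem_nhds hx)).differentiableAt (by norm_num)).lineDeriv_eq_fderiv

lemma partialDeriv_partialDeriv_eq_fderiv (hU : IsOpen U) (hF : ContDiffOn ℝ 2 F U)
    {x : Fin d → ℝ} (hx : x ∈ U) (i j : Fin d) :
    partialDeriv i (partialDeriv j F) x =
      fderiv ℝ (fderiv ℝ F) x (Pi.single i 1) (Pi.single j 1) := by
  have h2 : HasFDerivAt (fderiv ℝ F) (fderiv ℝ (fderiv ℝ F) x) x :=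
    (((hF.contDiffAt (hU.mem_nhds hx)).fderiv_right (m := 1) (by norm_num)).differentiableAt
      (by norm_num)).hasFDerivAt
  have h3 : HasFDerivAt (fun y => fderiv ℝ F y (Pi.single j 1))
      ((fderiv ℝ (fderiv ℝ F) x).flip (Pi.single j 1)) x := by
    simpa using h2.clm_apply (hasFDerivAt_const (Pi.single j (1 : ℝ)) x)
  have h4 : HasFDerivAt (partialDeriv j F)
      ((fderiv ℝ (fderiv ℝ F) x).flip (Pi.single j 1)) x :=
    h3.congr_of_eventuallyEq (by
      filter_upwards [hU.mem_nhds hx] with y hy using partialDeriv_eq_fderiv hU hF hy j)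
  rw [partialDeriv, (h4.hasLineDerivAt _).lineDeriv]
  rfl

lemma fderiv_apply_eq_sum (hU : IsOpen U) (hF : ContDiffOn ℝ 2 F U) {x : Fin d → ℝ}
    (hx : x ∈ U) (h : Fin d → ℝ) : fderiv ℝ F x h = ∑ j, partialDeriv j F x * h j := by
  conv_lhs => rw [← Finset.univ_sum_single h]
  rw [map_sum]
  refine Finset.sum_congr rfl fun j _ => ?_
  rw [partialDeriv_eq_fderiv hU hF hx, mul_comm, ← smul_eq_mul, ← map_smul, ← Pi.single_smul]
  simp

lemma fderiv_fderiv_apply_eq_sum (hU : IsOpen U) (hF : ContDiffOn ℝ 2 F U) {x : Fin d → ℝ}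
    (hx : x ∈ U) (h : Fin d → ℝ) : fderiv ℝ (fderiv ℝ F) x h h =
      ∑ i, ∑ j, partialDeriv i (partialDeriv j F) x * (h i * h j) := by
  have e : h = ∑ j, h j • (Pi.single j 1 : Fin d → ℝ) := by
    conv_lhs => rw [← Finset.univ_sum_single h]
    refine Finset.sum_congr rfl fun j _ => ?_
    rw [← Pi.single_smul]; simp
  conv_lhs => rw [e]
  simp only [map_sum, map_smul, sum_apply, smul_apply,
    smul_eq_mul, Finset.mul_sum]
  rw [Finset.sum_comm]
  refine Finset.sum_congr rfl fun i _ => Finset.sum_congr rfl fun j _ => ?_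
  rw [partialDeriv_partialDeriv_eq_fderiv hU hF hx]
  ring

/-- The norm is the sup norm, attained at some coordinate; `hk0` serves the empty index set. -/
lemma norm_pow_le_sum (h : Fin d → ℝ) {k : ℕ} (hk : Even k) (hk0 : k ≠ 0) :
    ‖h‖ ^ k ≤ ∑ j, h j ^ k := by
  have h0 : ∀ j, 0 ≤ h j ^ k := fun j => hk.pow_nonneg _
  rcases isEmpty_or_nonempty (Fin d) with hd | hd
  · rw [Subsingleton.elim h 0]; simp [hk0]
  · obtain ⟨j, -, hj⟩ := Finset.exists_max_image Finset.univ (fun j => ‖h j‖) Finset.univ_nonempty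
    have hle : ‖h‖ ≤ ‖h j‖ :=
      (pi_norm_le_iff_of_nonneg (norm_nonneg _)).2 fun i => hj i (Finset.mem_univ i)
    refine (pow_le_pow_left₀ (norm_nonneg _) hle k).trans ?_
    rw [Real.norm_eq_abs, hk.pow_abs]
    exact Finset.single_le_sum (f := fun j => h j ^ k) (fun j _ => h0 j) (Finset.mem_univ j)

end Partial


/-! ### Mean and variance of the estimator -/

section Reduction

variable {d : ℕ}

/-- The law on `ℕ^d` with independent Poisson coordinates of rates `m_j x_j`. -/
noncomputable def poissonProd (m : Fin d → ℕ) (x : Fin d → ℝ) : Measure (Fin d → ℕ) :=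
  Measure.pi fun j => poissonMeasure (Real.toNNReal (m j * x j))

instance (m : Fin d → ℕ) (x : Fin d → ℝ) : IsProbabilityMeasure (poissonProd m x) := by
  unfold poissonProd; infer_instance

/-- The grid point `k / m`. -/
noncomputable def gridPoint (m k : Fin d → ℕ) : Fin d → ℝ := fun j => (k j : ℝ) / (m j : ℝ)

lemma poissonProd_real_singleton (k m : Fin d → ℕ) {x : Fin d → ℝ} (hx : ∀ j, 0 ≤ x j) :
    (poissonProd m x).real {k} = poissonWeight k m x := by
  rw [poissonProd, measureReal_def, Measure.pi_singleton, ENNReal.toReal_prod, poissonWeight]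
  refine Finset.prod_congr rfl fun j _ => ?_
  rw [← measureReal_def, poissonMeasure_real_singleton,
    Real.coe_toNNReal _ (mul_nonneg (Nat.cast_nonneg _) (hx j))]

/-- The probability that the random point `T` dominates `y`. -/
noncomputable def upperProb {α : Type*} [MeasurableSpace α] (Q : Measure α)
    (T : α → Fin d → ℝ) (y : Fin d → ℝ) : ℝ := Q.real {k | y ≤ T k}

/-- The series is an integral against the product-Poisson law, and integrating each indicator over
the grid point leaves the probability of dominating `X i`. The estimator thus becomes a mean of
bounded functions of single observations. -/
lemma estimator_eq_sum_upperProb {n : ℕ} (m : Fin d → ℕ) (X : Fin n → Fin d → ℝ) {x : Fin d → ℝ}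
    (hx : ∀ j, 0 ≤ x j) :
    estimator m X x = (1 / (n : ℝ)) * ∑ i, upperProb (poissonProd m x) (gridPoint m) (X i) := by
  have hi : ∀ i, Integrable (fun k => Set.indicator (Set.Iic (gridPoint m k))
      (fun _ => (1 : ℝ)) (X i)) (poissonProd m x) := by
    intro i
    refine (integrable_const (1 : ℝ)).mono' (Measurable.of_discrete).aestronglyMeasurable
      (ae_of_all _ fun k => ?_)
    by_cases h : X i ∈ Set.Iic (gridPoint m k) <;> simp [h]
  have hI : ∀ i, ∫ k, Set.indicator (Set.Iic (gridPoint m k)) (fun _ => (1 : ℝ)) (X i)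
      ∂(poissonProd m x) = upperProb (poissonProd m x) (gridPoint m) (X i) := by
    intro i
    rw [upperProb, ← integral_indicator_one (.of_discrete)]
    rfl
  have hE : estimator m X x = ∫ k, empiricalDistFun X (gridPoint m k) ∂(poissonProd m x) := by
    rw [integral_countable]
    · refine tsum_congr fun k => ?_
      rw [poissonProd_real_singleton k m hx, smul_eq_mul, mul_comm]
      rfl
    · exact (integrable_finsetSum _ fun i _ => hi i).const_mul _
  rw [hE]
  simp only [empiricalDistFun]
  rw [integral_const_mul, integral_finsetSum _ fun i _ => hi i]
  simp_rw [hI]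

variable {α : Type*} [MeasurableSpace α] {Q : Measure α} [IsProbabilityMeasure Q]
  {T : α → Fin d → ℝ} {μ : Measure (Fin d → ℝ)} [IsProbabilityMeasure μ]

lemma upperProb_mem_Icc (y : Fin d → ℝ) : upperProb Q T y ∈ Set.Icc (0 : ℝ) 1 :=
  ⟨measureReal_nonneg, measureReal_le_one⟩

lemma measurableSet_le_comp (hT : Measurable T) :
    MeasurableSet {p : (Fin d → ℝ) × α | p.1 ≤ T p.2} :=
  measurableSet_le measurable_fst (hT.comp measurable_snd)

lemma measurable_upperProb (hT : Measurable T) : Measurable (upperProb Q T) :=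
  (measurable_measure_prodMk_left (measurableSet_le_comp hT)).ennreal_toReal

/-- Fubini: both sides are the probability that an independent observation lies below `T`. -/
lemma integral_upperProb (hT : Measurable T) :
    ∫ y, upperProb Q T y ∂μ = ∫ k, distFun μ (T k) ∂Q := by
  have hm := measurableSet_le_comp hT
  have h1 : ∀ y, upperProb Q T y =
      ∫ k, Set.indicator {p : (Fin d → ℝ) × α | p.1 ≤ T p.2} 1 (y, k) ∂Q := fun y => by
    have hy : MeasurableSet {k | y ≤ T k} := measurable_prodMk_left (x := y) hm
    rw [upperProb, ← integral_indicator_one hy]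
    rfl
  have h2 : ∀ k, distFun μ (T k) =
      ∫ y, Set.indicator {p : (Fin d → ℝ) × α | p.1 ≤ T p.2} 1 (y, k) ∂μ := fun k => by
    rw [distFun, ← integral_indicator_one measurableSet_Iic]
    rfl
  simp_rw [h1, h2]
  exact integral_integral_swap ((integrable_const (1 : ℝ)).indicator hm)

/-- A squared probability is the probability that two independent copies both dominate `y`, that is,
that their minimum does. This reduces to the first-moment identity for the pair. -/
lemma integral_upperProb_sq (hT : Measurable T) :
    ∫ y, upperProb Q T y ^ 2 ∂μ = ∫ p : α × α, distFun μ (T p.1 ⊓ T p.2) ∂(Q.prod Q) := by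
  rw [← integral_upperProb (T := fun p : α × α => T p.1 ⊓ T p.2)
    (measurable_pi_lambda _ fun j => ((measurable_pi_apply j).comp (hT.comp measurable_fst)).min
      ((measurable_pi_apply j).comp (hT.comp measurable_snd)))]
  refine integral_congr_ae (ae_of_all _ fun y => ?_)
  simp only [upperProb]
  have : {p : α × α | y ≤ T p.1 ⊓ T p.2} = {k | y ≤ T k} ×ˢ {k | y ≤ T k} := by
    ext p; simp
  rw [this, measureReal_prod_prod, sq]

variable {n : ℕ} {Ω : Type*} [MeasurableSpace Ω] {P : Measure Ω} [IsProbabilityMeasure P]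
  {X : Fin n → Ω → Fin d → ℝ}

lemma memLp_upperProb_comp (hT : Measurable T) (hX : ∀ i, Measurable (X i)) (i : Fin n) :
    MemLp (fun ω => upperProb Q T (X i ω)) 2 P :=
  memLp_of_bounded (a := 0) (b := 1) (ae_of_all _ fun _ => upperProb_mem_Icc _)
    ((measurable_upperProb hT).comp (hX i)).aestronglyMeasurable 2

lemma integral_mean_upperProb (hT : Measurable T) (hn : 0 < n) (hX : ∀ i, Measurable (X i))
    (hlaw : ∀ i, P.map (X i) = μ) :
    ∫ ω, (1 / (n : ℝ)) * ∑ i, upperProb Q T (X i ω) ∂P = ∫ k, distFun μ (T k) ∂Q := by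
  have h : ∀ i, ∫ ω, upperProb Q T (X i ω) ∂P = ∫ k, distFun μ (T k) ∂Q := fun i => by
    rw [← integral_upperProb hT, ← hlaw i, integral_map (hX i).aemeasurable
      (measurable_upperProb hT).aestronglyMeasurable]
  rw [integral_const_mul, integral_finsetSum _ fun i _ =>
    (memLp_upperProb_comp hT hX i).integrable (by norm_num)]
  simp_rw [h]
  have : (n : ℝ) ≠ 0 := by positivity
  simp
  field_simp

lemma variance_mean_upperProb (hT : Measurable T) (hn : 0 < n) (hX : ∀ i, Measurable (X i))
    (hlaw : ∀ i, P.map (X i) = μ) (hind : iIndepFun X P) :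
    variance (fun ω => (1 / (n : ℝ)) * ∑ i, upperProb Q T (X i ω)) P =
      (n : ℝ)⁻¹ * (∫ p : α × α, distFun μ (T p.1 ⊓ T p.2) ∂(Q.prod Q) -
        (∫ k, distFun μ (T k) ∂Q) ^ 2) := by
  have hG := measurable_upperProb (Q := Q) hT
  have hμ : MemLp (upperProb Q T) 2 μ :=
    memLp_of_bounded (a := 0) (b := 1) (ae_of_all _ fun _ => upperProb_mem_Icc _)
      hG.aestronglyMeasurable 2
  have hv : ∀ i, variance (fun ω => upperProb Q T (X i ω)) P =
      ∫ p : α × α, distFun μ (T p.1 ⊓ T p.2) ∂(Q.prod Q) - (∫ k, distFun μ (T k) ∂Q) ^ 2 := by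
    intro i
    rw [← integral_upperProb hT, ← integral_upperProb_sq hT]
    have h1 : variance (upperProb Q T) (P.map (X i)) =
        variance (fun ω => upperProb Q T (X i ω)) P :=
      variance_map hG.aemeasurable (hX i).aemeasurable
    rw [← h1, hlaw i, variance_eq_sub hμ]
    rfl
  have hs : variance (∑ i, fun ω => upperProb Q T (X i ω)) P =
      ∑ i, variance (fun ω => upperProb Q T (X i ω)) P :=
    IndepFun.variance_sum (fun i _ => memLp_upperProb_comp hT hX i)
      fun i _ j _ hij => (hind.indepFun hij).comp hG hG
  rw [variance_const_mul]
  have e : (fun ω => ∑ i, upperProb Q T (X i ω)) = ∑ i, fun ω => upperProb Q T (X i ω) := by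
    ext ω; simp
  rw [e, hs]
  simp_rw [hv]
  have : (n : ℝ) ≠ 0 := by positivity
  simp
  field_simp

end Reduction


/-! ### Moments of the random grid point -/

section GridMoments

variable {d : ℕ} {m : Fin d → ℕ} {x : Fin d → ℝ}

lemma gridPoint_sub_eq (hm : ∀ j, 0 < m j) (hx : ∀ j, 0 ≤ x j) (k : Fin d → ℕ) (j : Fin d) :
    gridPoint m k j - x j = ((k j : ℝ) - (Real.toNNReal (m j * x j) : ℝ)) * (m j : ℝ)⁻¹ := by
  have : (m j : ℝ) ≠ 0 := by exact_mod_cast (hm j).ne'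
  rw [Real.coe_toNNReal _ (mul_nonneg (Nat.cast_nonneg _) (hx j)), gridPoint]
  field_simp

lemma integrable_gridPoint_sub_pow (hm : ∀ j, 0 < m j) (hx : ∀ j, 0 ≤ x j) (j : Fin d) (a : ℕ) :
    Integrable (fun k => (gridPoint m k j - x j) ^ a) (poissonProd m x) := by
  simp_rw [gridPoint_sub_eq hm hx, mul_pow]
  have h := integrable_comp_eval (μ := fun j => poissonMeasure (Real.toNNReal (m j * x j)))
    (i := j) (integrable_sub_pow_poissonMeasure (Real.toNNReal (m j * x j))
      (Real.toNNReal (m j * x j)) a)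
  exact h.mul_const _

lemma integral_gridPoint_sub_pow (hm : ∀ j, 0 < m j) (hx : ∀ j, 0 ≤ x j) (j : Fin d) (a : ℕ) :
    ∫ k, (gridPoint m k j - x j) ^ a ∂(poissonProd m x) =
      (∫ n : ℕ, ((n : ℝ) - (Real.toNNReal (m j * x j) : ℝ)) ^ a
        ∂(poissonMeasure (Real.toNNReal (m j * x j)))) * ((m j : ℝ)⁻¹) ^ a := by
  simp_rw [gridPoint_sub_eq hm hx, mul_pow]
  have h := integral_comp_eval (μ := fun j => poissonMeasure (Real.toNNReal (m j * x j)))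
    (i := j) (f := fun n : ℕ => ((n : ℝ) - (Real.toNNReal (m j * x j) : ℝ)) ^ a) (by fun_prop)
  rw [integral_mul_const, ← h, poissonProd]

lemma integrable_gridPoint_sub (hm : ∀ j, 0 < m j) (hx : ∀ j, 0 ≤ x j) (j : Fin d) :
    Integrable (fun k => gridPoint m k j - x j) (poissonProd m x) := by
  simpa using integrable_gridPoint_sub_pow hm hx j 1

lemma integral_gridPoint_sub (hm : ∀ j, 0 < m j) (hx : ∀ j, 0 ≤ x j) (j : Fin d) :
    ∫ k, (gridPoint m k j - x j) ∂(poissonProd m x) = 0 := by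
  have h := integral_gridPoint_sub_pow hm hx j 1
  simp only [pow_one, integral_sub_poissonMeasure, zero_mul] at h
  exact h

lemma integral_gridPoint_sub_sq (hm : ∀ j, 0 < m j) (hx : ∀ j, 0 ≤ x j) (j : Fin d) :
    ∫ k, (gridPoint m k j - x j) ^ 2 ∂(poissonProd m x) = x j / m j := by
  have : (m j : ℝ) ≠ 0 := by exact_mod_cast (hm j).ne'
  rw [integral_gridPoint_sub_pow hm hx, integral_sub_sq_poissonMeasure,
    Real.coe_toNNReal _ (mul_nonneg (Nat.cast_nonneg _) (hx j))]
  field_simp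

lemma integral_gridPoint_sub_pow_four_le (hm : ∀ j, 0 < m j) (hx : ∀ j, 0 ≤ x j) (j : Fin d) :
    ∫ k, (gridPoint m k j - x j) ^ 4 ∂(poissonProd m x) ≤
      (3 * x j ^ 2 + x j) / (m j : ℝ) ^ 2 := by
  have h1 : (1 : ℝ) ≤ m j := by exact_mod_cast hm j
  have h0 : (0 : ℝ) < m j := by linarith
  rw [integral_gridPoint_sub_pow hm hx, integral_sub_pow_four_poissonMeasure,
    Real.coe_toNNReal _ (mul_nonneg (Nat.cast_nonneg _) (hx j))]
  have e : (3 * ((m j : ℝ) * x j) ^ 2 + m j * x j) * ((m j : ℝ)⁻¹) ^ 4 =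
      (3 * x j ^ 2 + x j / m j) / (m j : ℝ) ^ 2 := by field_simp
  rw [e]
  gcongr
  exact div_le_self (hx j) h1

lemma integrable_gridPoint_sub_mul (hm : ∀ j, 0 < m j) (hx : ∀ j, 0 ≤ x j) (i j : Fin d) :
    Integrable (fun k => (gridPoint m k i - x i) * (gridPoint m k j - x j)) (poissonProd m x) := by
  refine ((integrable_gridPoint_sub_pow hm hx i 2).add
    (integrable_gridPoint_sub_pow hm hx j 2)).mono' (Measurable.of_discrete).aestronglyMeasurable
    (ae_of_all _ fun k => ?_)
  simp only [Real.norm_eq_abs, Pi.add_apply, abs_le]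
  constructor <;> nlinarith [sq_nonneg (gridPoint m k i - x i - (gridPoint m k j - x j)),
    sq_nonneg (gridPoint m k i - x i + (gridPoint m k j - x j))]

lemma integral_gridPoint_sub_mul (hm : ∀ j, 0 < m j) (hx : ∀ j, 0 ≤ x j) {i j : Fin d}
    (hij : i ≠ j) :
    ∫ k, (gridPoint m k i - x i) * (gridPoint m k j - x j) ∂(poissonProd m x) = 0 := by
  have hind : iIndepFun (fun j k => gridPoint m k j - x j) (poissonProd m x) :=
    iIndepFun_pi (X := fun j (n : ℕ) => (n : ℝ) / (m j : ℝ) - x j) fun j => by fun_prop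
  rw [(hind.indepFun hij).integral_fun_mul_eq_mul_integral
    (Measurable.of_discrete).aestronglyMeasurable (Measurable.of_discrete).aestronglyMeasurable,
    integral_gridPoint_sub hm hx, zero_mul]

lemma measurePreserving_eval_prod_poissonProd (j : Fin d) :
    MeasurePreserving (fun p : (Fin d → ℕ) × (Fin d → ℕ) => (p.1 j, p.2 j))
      ((poissonProd m x).prod (poissonProd m x))
      ((poissonMeasure (Real.toNNReal (m j * x j))).prod
        (poissonMeasure (Real.toNNReal (m j * x j)))) := by
  have h : MeasurePreserving (Function.eval j) (poissonProd m x)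
      (poissonMeasure (Real.toNNReal (m j * x j))) := measurePreserving_eval _ j
  exact h.prod h

lemma integrable_fst_gridPoint_sub_pow (hm : ∀ j, 0 < m j) (hx : ∀ j, 0 ≤ x j) (j : Fin d)
    (a : ℕ) : Integrable (fun p : (Fin d → ℕ) × (Fin d → ℕ) => (gridPoint m p.1 j - x j) ^ a)
      ((poissonProd m x).prod (poissonProd m x)) :=
  (integrable_gridPoint_sub_pow hm hx j a).comp_fst _

lemma integrable_snd_gridPoint_sub_pow (hm : ∀ j, 0 < m j) (hx : ∀ j, 0 ≤ x j) (j : Fin d)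
    (a : ℕ) : Integrable (fun p : (Fin d → ℕ) × (Fin d → ℕ) => (gridPoint m p.2 j - x j) ^ a)
      ((poissonProd m x).prod (poissonProd m x)) :=
  (integrable_gridPoint_sub_pow hm hx j a).comp_snd _

lemma integral_fst_gridPoint_sub_pow (j : Fin d) (a : ℕ) :
    ∫ p : (Fin d → ℕ) × (Fin d → ℕ), (gridPoint m p.1 j - x j) ^ a
      ∂((poissonProd m x).prod (poissonProd m x)) =
    ∫ k, (gridPoint m k j - x j) ^ a ∂(poissonProd m x) := by
  simpa using integral_fun_fst (μ := poissonProd m x) (ν := poissonProd m x)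
    (fun k => (gridPoint m k j - x j) ^ a)

lemma integral_snd_gridPoint_sub_pow (j : Fin d) (a : ℕ) :
    ∫ p : (Fin d → ℕ) × (Fin d → ℕ), (gridPoint m p.2 j - x j) ^ a
      ∂((poissonProd m x).prod (poissonProd m x)) =
    ∫ k, (gridPoint m k j - x j) ^ a ∂(poissonProd m x) := by
  simpa using integral_fun_snd (μ := poissonProd m x) (ν := poissonProd m x)
    (fun k => (gridPoint m k j - x j) ^ a)

/-- The mean absolute difference of two independent Poisson variables of rate `r`. -/
noncomputable def poissonMeanDiff (r : ℝ≥0) : ℝ :=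
  ∫ p : ℕ × ℕ, |(p.1 : ℝ) - p.2| ∂((poissonMeasure r).prod (poissonMeasure r))

lemma integrable_abs_sub_poissonMeasure (r : ℝ≥0) :
    Integrable (fun p : ℕ × ℕ => |(p.1 : ℝ) - p.2|)
      ((poissonMeasure r).prod (poissonMeasure r)) := by
  simpa using (integrable_sub_pow_prod_poissonMeasure r 1).abs

/-- This is min(a,b) = (a + b - |a - b|)/2; the exponents 1 match the form of the moment lemmas. -/
lemma gridPoint_inf_sub_eq (k l : Fin d → ℕ) (j : Fin d) :
    (gridPoint m k ⊓ gridPoint m l) j - x j = (1 / 2) * ((gridPoint m k j - x j) ^ 1 +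
      ((gridPoint m l j - x j) ^ 1 + -(|(k j : ℝ) - l j| * (m j : ℝ)⁻¹))) := by
  have : |(k j : ℝ) - l j| * (m j : ℝ)⁻¹ = |gridPoint m k j - gridPoint m l j| := by
    simp only [gridPoint]
    rw [← sub_div, abs_div, Nat.abs_cast, div_eq_mul_inv]
  rw [this, Pi.inf_apply, pow_one, pow_one]
  rcases le_total (gridPoint m k j) (gridPoint m l j) with h | h
  · rw [inf_eq_left.2 h, abs_of_nonpos (by linarith)]; ring
  · rw [inf_eq_right.2 h, abs_of_nonneg (by linarith)]; ring

lemma integrable_gridPoint_inf_sub (hm : ∀ j, 0 < m j) (hx : ∀ j, 0 ≤ x j) (j : Fin d) :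
    Integrable (fun p : (Fin d → ℕ) × (Fin d → ℕ) =>
      (gridPoint m p.1 ⊓ gridPoint m p.2) j - x j)
      ((poissonProd m x).prod (poissonProd m x)) := by
  simp_rw [gridPoint_inf_sub_eq]
  have h := (measurePreserving_eval_prod_poissonProd (m := m) (x := x) j).integrable_comp_of_integrable
    (integrable_abs_sub_poissonMeasure _)
  exact ((integrable_fst_gridPoint_sub_pow hm hx j 1).add
    ((integrable_snd_gridPoint_sub_pow hm hx j 1).add (h.mul_const _).neg)).const_mul _

lemma integral_gridPoint_inf_sub (hm : ∀ j, 0 < m j) (hx : ∀ j, 0 ≤ x j) (j : Fin d) :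
    ∫ p : (Fin d → ℕ) × (Fin d → ℕ), ((gridPoint m p.1 ⊓ gridPoint m p.2) j - x j)
      ∂((poissonProd m x).prod (poissonProd m x)) =
      -(poissonMeanDiff (Real.toNNReal (m j * x j)) / (2 * m j)) := by
  simp_rw [gridPoint_inf_sub_eq]
  have hmp := measurePreserving_eval_prod_poissonProd (m := m) (x := x) j
  have h := hmp.integrable_comp_of_integrable (integrable_abs_sub_poissonMeasure _)
  have hI : ∫ p : (Fin d → ℕ) × (Fin d → ℕ), |(p.1 j : ℝ) - p.2 j|
      ∂((poissonProd m x).prod (poissonProd m x)) =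
      poissonMeanDiff (Real.toNNReal (m j * x j)) := by
    rw [poissonMeanDiff, ← hmp.map_eq, integral_map .of_discrete (by fun_prop)]
  have h' : Integrable (fun p : (Fin d → ℕ) × (Fin d → ℕ) =>
      -(|(p.1 j : ℝ) - p.2 j| * (m j : ℝ)⁻¹)) ((poissonProd m x).prod (poissonProd m x)) :=
    (h.mul_const _).neg
  have h'' : Integrable (fun p : (Fin d → ℕ) × (Fin d → ℕ) => (gridPoint m p.2 j - x j) ^ 1 +
      -(|(p.1 j : ℝ) - p.2 j| * (m j : ℝ)⁻¹)) ((poissonProd m x).prod (poissonProd m x)) :=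
    (integrable_snd_gridPoint_sub_pow hm hx j 1).add h'
  rw [integral_const_mul, integral_add (integrable_fst_gridPoint_sub_pow hm hx j 1) h'',
    integral_add (integrable_snd_gridPoint_sub_pow hm hx j 1) h',
    integral_fst_gridPoint_sub_pow, integral_snd_gridPoint_sub_pow, integral_neg,
    integral_mul_const, hI]
  simp only [pow_one, integral_gridPoint_sub hm hx]
  rw [mul_comm (2 : ℝ), ← div_div, div_eq_mul_inv _ (m j : ℝ)]
  ring

/-- The limit theorem multiplied back by √r, so that the error is relative to √r and depends on the
rate alone. -/
lemma exists_abs_poissonMeanDiff_sub_le {η : ℝ} (hη : 0 < η) :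
    ∃ Λ : ℝ, ∀ r : ℝ≥0, Λ ≤ r → 0 < (r : ℝ) →
      |poissonMeanDiff r - 2 * √(r / Real.pi)| ≤ η * √(r : ℝ) := by
  obtain ⟨Λ, hΛ⟩ := Metric.tendsto_atTop.1 tendsto_integral_abs_sub_poissonMeasure η hη
  refine ⟨Λ, fun r hr hr0 => ?_⟩
  have h := (hΛ r (by exact_mod_cast hr)).le
  have hs : 0 < √(r : ℝ) := Real.sqrt_pos.2 hr0
  rw [Real.dist_eq] at h
  have e : poissonMeanDiff r - 2 * √(r / Real.pi) =
      √(r : ℝ) * ((√(r : ℝ))⁻¹ * poissonMeanDiff r - 2 / √Real.pi) := by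
    rw [Real.sqrt_div r.coe_nonneg]
    field_simp
  rw [e, abs_mul, abs_of_pos hs, mul_comm]
  exact mul_le_mul_of_nonneg_right h hs.le

end GridMoments


/-! ### Asymptotic expansions -/

lemma abs_integral_sub_integral_le {α : Type*} [MeasurableSpace α] {ρ : Measure α}
    {f p b : α → ℝ} (hf : Integrable f ρ) (hp : Integrable p ρ) (hb : Integrable b ρ)
    (h : ∀ a, |f a - p a| ≤ b a) : |∫ a, f a ∂ρ - ∫ a, p a ∂ρ| ≤ ∫ a, b a ∂ρ := by
  rw [← integral_sub hf hp]
  exact abs_integral_le_integral_abs.trans (integral_mono (hf.sub hp).abs hb h)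

section Expansion

variable {d : ℕ} {μ : Measure (Fin d → ℝ)} [IsProbabilityMeasure μ]

lemma distFun_mem_Icc (y : Fin d → ℝ) : distFun μ y ∈ Set.Icc (0 : ℝ) 1 :=
  ⟨measureReal_nonneg, measureReal_le_one⟩

lemma integrable_distFun_comp {α : Type*} [MeasurableSpace α] [DiscreteMeasurableSpace α]
    {ρ : Measure α} [IsFiniteMeasure ρ] (T : α → Fin d → ℝ) :
    Integrable (fun a => distFun μ (T a)) ρ :=
  (integrable_const (1 : ℝ)).mono' (Measurable.of_discrete).aestronglyMeasurable
    (ae_of_all _ fun a => by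
      rw [Real.norm_eq_abs, abs_of_nonneg (distFun_mem_Icc _).1]
      exact (distFun_mem_Icc _).2)

lemma exists_abs_distFun_taylor_le (hF : RegularInterior (distFun μ)) {S : Set (Fin d → ℝ)}
    (hS : IsCompact S) (hSpos : S ⊆ interiorOrthant d) {ε : ℝ} (hε : 0 < ε) :
    ∃ C : ℝ, 0 ≤ C ∧ ∀ x ∈ S, ∀ y, |distFun μ y - (distFun μ x +
        (∑ j, partialDeriv j (distFun μ) x * (y j - x j) +
        (1 / 2) * ∑ i, ∑ j, partialDeriv i (partialDeriv j (distFun μ)) x *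
          ((y i - x i) * (y j - x j))))| ≤
      ∑ j, (ε * (y j - x j) ^ 2 + C * (y j - x j) ^ 4) := by
  have hU := isOpen_interiorOrthant d
  obtain ⟨C, hC, h⟩ := exists_abs_taylor_two_le hU hF.contDiffOn
    (fun x y => by
      have hx := distFun_mem_Icc (μ := μ) x
      have hy := distFun_mem_Icc (μ := μ) y
      rw [abs_le]
      constructor <;> linarith [hx.1, hx.2, hy.1, hy.2]) hS hSpos hε
  refine ⟨C, hC, fun x hx y => ?_⟩
  have h1 := h x hx y
  rw [fderiv_apply_eq_sum hU hF.contDiffOn (hSpos hx),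
    fderiv_fderiv_apply_eq_sum hU hF.contDiffOn (hSpos hx)] at h1
  simp only [Pi.sub_apply] at h1
  have n2 := norm_pow_le_sum (y - x) (k := 2) (by decide) (by norm_num)
  have n4 := norm_pow_le_sum (y - x) (k := 4) (by decide) (by norm_num)
  simp only [Pi.sub_apply] at n2 n4
  rw [Finset.sum_add_distrib, ← Finset.mul_sum, ← Finset.mul_sum]
  calc _ = _ := by congr 1; ring
    _ ≤ _ := h1
    _ ≤ _ := by gcongr

lemma exists_abs_partialDeriv_le {F : (Fin d → ℝ) → ℝ} (hF : RegularInterior F)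
    {S : Set (Fin d → ℝ)} (hS : IsCompact S) (hSpos : S ⊆ interiorOrthant d) :
    ∃ M : ℝ, 0 ≤ M ∧ ∀ x ∈ S, (∀ i, |partialDeriv i F x| ≤ M) ∧
      (∀ i j, |partialDeriv i (partialDeriv j F) x| ≤ M) := by
  obtain ⟨δ, hδ, M, hM⟩ := hF.bounded S hS hSpos
  refine ⟨|M|, abs_nonneg _, fun x hx => ?_⟩
  have h := hM x ⟨hSpos hx, x, hx, by simpa using hδ.le⟩
  exact ⟨fun i => (h.1 i).trans (le_abs_self _), fun i j => (h.2 i j).trans (le_abs_self _)⟩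

lemma exists_apply_le_of_isCompact {S : Set (Fin d → ℝ)} (hS : IsCompact S) :
    ∃ B : ℝ, 0 ≤ B ∧ ∀ x ∈ S, ∀ j, x j ≤ B := by
  obtain ⟨B, hB⟩ := hS.isBounded.exists_norm_le
  exact ⟨|B|, abs_nonneg _, fun x hx j => (le_abs_self _).trans <|
    (norm_le_pi_norm x j).trans ((hB x hx).trans (le_abs_self _))⟩

variable [NeZero d]

lemma exists_le_apply_of_isCompact {S : Set (Fin d → ℝ)} (hS : IsCompact S)
    (hSpos : S ⊆ interiorOrthant d) : ∃ c : ℝ, 0 < c ∧ ∀ x ∈ S, ∀ j, c ≤ x j := by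
  obtain ⟨c, hc, h⟩ := hS.exists_forall_le' (a := (0 : ℝ))
    (f := fun x => Finset.univ.inf' Finset.univ_nonempty fun j => x j)
    (Continuous.finset_inf'_apply _ fun j _ => continuous_apply j).continuousOn
    (fun x hx => (Finset.lt_inf'_iff _).2 fun j _ => hSpos hx j)
  exact ⟨c, hc, fun x hx j => (h x hx).trans (Finset.inf'_le _ (Finset.mem_univ j))⟩

lemma mMin_le (m : Fin d → ℕ) (j : Fin d) : mMin m ≤ m j :=
  Finset.inf'_le _ (Finset.mem_univ j)

lemma integral_gridPoint_remainder_le {m : Fin d → ℕ} (hm : ∀ j, 0 < m j) (h1 : 1 ≤ mMin m)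
    {x : Fin d → ℝ} {B : ℝ} (hx : ∀ j, 0 ≤ x j) (hB : ∀ j, x j ≤ B) {a b : ℝ} (ha : 0 ≤ a)
    (hb : 0 ≤ b) :
    ∑ j, (a * ∫ k, (gridPoint m k j - x j) ^ 2 ∂(poissonProd m x) +
      b * ∫ k, (gridPoint m k j - x j) ^ 4 ∂(poissonProd m x)) ≤
      d * (a * B / mMin m + b * (3 * B ^ 2 + B) / (mMin m : ℝ) ^ 2) := by
  have h : ∀ j, a * ∫ k, (gridPoint m k j - x j) ^ 2 ∂(poissonProd m x) +
      b * ∫ k, (gridPoint m k j - x j) ^ 4 ∂(poissonProd m x) ≤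
      a * B / mMin m + b * (3 * B ^ 2 + B) / (mMin m : ℝ) ^ 2 := by
    intro j
    have h0 : (0 : ℝ) < mMin m := by exact_mod_cast h1
    have hj : (mMin m : ℝ) ≤ m j := by exact_mod_cast mMin_le m j
    have hxj := hx j
    have hBj := hB j
    have hB0 := hxj.trans hBj
    rw [integral_gridPoint_sub_sq hm hx, mul_div_assoc, mul_div_assoc]
    have h4 := integral_gridPoint_sub_pow_four_le hm hx j
    have h4' : (3 * x j ^ 2 + x j) / (m j : ℝ) ^ 2 ≤ (3 * B ^ 2 + B) / (mMin m : ℝ) ^ 2 := by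
      gcongr
    refine add_le_add (mul_le_mul_of_nonneg_left ?_ ha)
      (mul_le_mul_of_nonneg_left (h4.trans h4') hb)
    gcongr
  refine (Finset.sum_le_sum fun j _ => h j).trans ?_
  simp [mul_add]

/-- The bias expansion. -/
lemma exists_abs_integral_distFun_sub_le (hF : RegularInterior (distFun μ))
    {S : Set (Fin d → ℝ)} (hS : IsCompact S) (hSpos : S ⊆ interiorOrthant d) {ε : ℝ}
    (hε : 0 < ε) :
    ∃ M : ℕ, ∀ m : Fin d → ℕ, (∀ j, 0 < m j) → M ≤ mMin m → ∀ x ∈ S,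
      |(∫ k, distFun μ (gridPoint m k) ∂(poissonProd m x)) - distFun μ x -
        (1 / 2) * ∑ j, x j / (m j : ℝ) * partialDeriv j (partialDeriv j (distFun μ)) x| ≤
      ε * (mMin m : ℝ)⁻¹ := by
  obtain ⟨B, hB0, hB⟩ := exists_apply_le_of_isCompact hS
  -- The second moments sum to at most d B / m_min, so this weight keeps their share below ε / (2
  -- m_min). The next threshold `M` does the same for the fourth moments, which are O(m_min⁻²).
  set a : ℝ := ε / (2 * (d * B + 1)) with ha_def
  have ha : 0 < a := by positivity
  obtain ⟨C, hC0, hC⟩ := exists_abs_distFun_taylor_le hF hS hSpos ha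
  obtain ⟨M, hM⟩ := exists_nat_gt (2 * (d * (C * (3 * B ^ 2 + B))) / ε)
  refine ⟨M + 1, fun m hm hmM x hx => ?_⟩
  have h1 : 1 ≤ mMin m := by omega
  have hm0 : (0 : ℝ) < mMin m := by exact_mod_cast h1
  have hx0 : ∀ j, 0 ≤ x j := fun j => (hSpos hx j).le
  set Q := poissonProd m x with hQ
  set D : (Fin d → ℕ) → Fin d → ℝ := fun k j => gridPoint m k j - x j with hD
  set F := distFun μ with hFdef
  have i1 : ∀ j ∈ Finset.univ, Integrable (fun k => partialDeriv j F x * D k j) Q := fun j _ =>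
    (integrable_gridPoint_sub hm hx0 j).const_mul _
  have i2 : ∀ i j, Integrable (fun k => partialDeriv i (partialDeriv j F) x * (D k i * D k j)) Q :=
    fun i j => (integrable_gridPoint_sub_mul hm hx0 i j).const_mul _
  have i2' : ∀ i ∈ Finset.univ, Integrable
      (fun k => ∑ j, partialDeriv i (partialDeriv j F) x * (D k i * D k j)) Q :=
    fun i _ => integrable_finsetSum _ fun j _ => i2 i j
  have i3 : Integrable (fun k => ∑ j, partialDeriv j F x * D k j) Q := integrable_finsetSum _ i1
  have i4 : Integrable (fun k => (1 / 2) * ∑ i, ∑ j,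
      partialDeriv i (partialDeriv j F) x * (D k i * D k j)) Q :=
    (integrable_finsetSum _ i2').const_mul _
  have i5 : Integrable (fun k => ∑ j, partialDeriv j F x * D k j + (1 / 2) * ∑ i, ∑ j,
      partialDeriv i (partialDeriv j F) x * (D k i * D k j)) Q := i3.add i4
  have i6 : Integrable (fun k => F x + (∑ j, partialDeriv j F x * D k j + (1 / 2) * ∑ i, ∑ j,
      partialDeriv i (partialDeriv j F) x * (D k i * D k j))) Q := (integrable_const _).add i5
  have j2 : ∀ j, Integrable (fun k => a * D k j ^ 2) Q := fun j =>
    (integrable_gridPoint_sub_pow hm hx0 j 2).const_mul _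
  have j4 : ∀ j, Integrable (fun k => C * D k j ^ 4) Q := fun j =>
    (integrable_gridPoint_sub_pow hm hx0 j 4).const_mul _
  have j5 : ∀ j ∈ Finset.univ, Integrable (fun k => a * D k j ^ 2 + C * D k j ^ 4) Q :=
    fun j _ => (j2 j).add (j4 j)
  have key := abs_integral_sub_integral_le (ρ := Q) (integrable_distFun_comp (gridPoint m))
    i6 (integrable_finsetSum _ j5)
    (fun k => hC x hx (gridPoint m k))
  have ep : ∫ k, (F x + (∑ j, partialDeriv j F x * D k j + (1 / 2) * ∑ i, ∑ j,
      partialDeriv i (partialDeriv j F) x * (D k i * D k j))) ∂Q =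
      F x + (1 / 2) * ∑ j, x j / (m j : ℝ) * partialDeriv j (partialDeriv j F) x := by
    rw [integral_add (integrable_const _) i5, integral_add i3 i4, integral_finsetSum _ i1,
      integral_const_mul, integral_finsetSum _ i2']
    simp_rw [integral_finsetSum _ fun j _ => i2 _ j, integral_const_mul]
    simp only [hD, hQ, integral_gridPoint_sub hm hx0]
    -- Distinct coordinates are independent and centred, so only the diagonal second derivatives
    -- contribute.
    have hdiag : ∀ i, ∑ j, partialDeriv i (partialDeriv j F) x *
        ∫ k, (gridPoint m k i - x i) * (gridPoint m k j - x j) ∂(poissonProd m x) =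
        x i / (m i : ℝ) * partialDeriv i (partialDeriv i F) x := by
      intro i
      rw [Finset.sum_eq_single i]
      · simp_rw [← sq]
        rw [integral_gridPoint_sub_sq hm hx0, mul_comm]
      · intro j _ hji
        rw [integral_gridPoint_sub_mul hm hx0 hji.symm, mul_zero]
      · simp
    simp_rw [hdiag]
    simp
  have eb : ∫ k, ∑ j, (a * D k j ^ 2 + C * D k j ^ 4) ∂Q =
      ∑ j, (a * ∫ k, (gridPoint m k j - x j) ^ 2 ∂(poissonProd m x) +
      C * ∫ k, (gridPoint m k j - x j) ^ 4 ∂(poissonProd m x)) := by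
    rw [integral_finsetSum _ j5]
    refine Finset.sum_congr rfl fun j _ => ?_
    rw [integral_add (j2 j) (j4 j), integral_const_mul, integral_const_mul]
  rw [ep, eb] at key
  have hrem := integral_gridPoint_remainder_le hm h1 hx0 (hB x hx) ha.le hC0
  rw [sub_sub]
  refine (key.trans hrem).trans ?_
  have hMm : 2 * (d * (C * (3 * B ^ 2 + B))) ≤ ε * mMin m := by
    have h2 : (M : ℝ) ≤ mMin m := by exact_mod_cast (by omega : M ≤ mMin m)
    rw [← div_le_iff₀' hε]
    exact hM.le.trans h2
  have e1 : (d : ℝ) * (a * B / mMin m) ≤ (ε / 2) * (mMin m : ℝ)⁻¹ := by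
    rw [div_eq_mul_inv (a * B), ← mul_assoc]
    refine mul_le_mul_of_nonneg_right ?_ (by positivity)
    rw [ha_def]
    have : (0 : ℝ) ≤ d * B := by positivity
    rw [← mul_assoc, mul_div_assoc', div_mul_eq_mul_div, div_le_div_iff₀ (by positivity) (by positivity)]
    nlinarith
  have e2 : (d : ℝ) * (C * (3 * B ^ 2 + B) / (mMin m : ℝ) ^ 2) ≤ (ε / 2) * (mMin m : ℝ)⁻¹ := by
    have e3 : ε / 2 * (mMin m : ℝ)⁻¹ * (mMin m : ℝ) ^ 2 = ε / 2 * mMin m := by field_simp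
    rw [mul_div_assoc', div_le_iff₀ (by positivity), e3]
    linarith
  rw [mul_add]
  linarith

/-- A coarse form of the bias, sufficient for replacing the squared mean by F(x)² in the variance.
-/
lemma exists_abs_integral_distFun_sub_le_div (hF : RegularInterior (distFun μ))
    {S : Set (Fin d → ℝ)} (hS : IsCompact S) (hSpos : S ⊆ interiorOrthant d) :
    ∃ C : ℝ, 0 ≤ C ∧ ∃ M : ℕ, ∀ m : Fin d → ℕ, (∀ j, 0 < m j) → M ≤ mMin m → ∀ x ∈ S,
      |(∫ k, distFun μ (gridPoint m k) ∂(poissonProd m x)) - distFun μ x| ≤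
        C / (mMin m : ℝ) := by
  obtain ⟨M, hM⟩ := exists_abs_integral_distFun_sub_le hF hS hSpos one_pos
  obtain ⟨B, hB0, hB⟩ := exists_apply_le_of_isCompact hS
  obtain ⟨K, hK0, hK⟩ := exists_abs_partialDeriv_le hF hS hSpos
  refine ⟨1 + 1 / 2 * (d * (B * K)), by positivity, M + 1, fun m hm hmM x hx => ?_⟩
  have h := hM m hm (by omega) x hx
  have hm0 : (0 : ℝ) < mMin m := by exact_mod_cast (by omega : 0 < mMin m)
  have hsum : |∑ j, x j / (m j : ℝ) * partialDeriv j (partialDeriv j (distFun μ)) x| ≤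
      d * (B * K) / mMin m := by
    refine (Finset.abs_sum_le_sum_abs _ _).trans ?_
    refine (Finset.sum_le_sum (g := fun _ => B * K / mMin m) fun j _ => ?_).trans_eq (by
      simp; ring)
    have hj : (mMin m : ℝ) ≤ m j := by exact_mod_cast mMin_le m j
    have hxj := (hSpos hx j).le
    rw [abs_mul, abs_of_nonneg (by positivity), ← div_mul_eq_mul_div]
    exact mul_le_mul (div_le_div₀ hB0 (hB x hx j) hm0 hj) ((hK x hx).2 j j) (abs_nonneg _)
      (by positivity)
  have e : (1 + 1 / 2 * (d * (B * K))) / (mMin m : ℝ) =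
      1 * (mMin m : ℝ)⁻¹ + 1 / 2 * (d * (B * K) / mMin m) := by field_simp
  rw [e]
  rw [abs_le] at *
  constructor <;> linarith [h.1, h.2, hsum.1, hsum.2]

end Expansion


/-- Absorbs O(1/m_min) errors into o(m_min^{-1/2}). -/
lemma exists_div_le_mul_inv_sqrt {C ε : ℝ} (hε : 0 < ε) :
    ∃ M : ℕ, ∀ k : ℕ, M ≤ k → C / (k : ℝ) ≤ ε * (√(k : ℝ))⁻¹ := by
  obtain ⟨M, hM⟩ := exists_nat_gt ((C / ε) ^ 2)
  refine ⟨M, fun k hk => ?_⟩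
  have hk' : (C / ε) ^ 2 < k := hM.trans_le (by exact_mod_cast hk)
  have hk0 : (0 : ℝ) < k := (sq_nonneg _).trans_lt hk'
  have hs : 0 < √(k : ℝ) := Real.sqrt_pos.2 hk0
  have h1 : C / ε ≤ √(k : ℝ) := Real.le_sqrt_of_sq_le hk'.le
  have h2 : C ≤ ε * √(k : ℝ) := by rwa [div_le_iff₀' hε] at h1
  rw [div_le_iff₀ hk0]
  nth_rewrite 2 [← Real.mul_self_sqrt hk0.le]
  rw [mul_assoc, inv_mul_cancel_left₀ hs.ne']
  exact h2

/-! ### Expansion at the minimum of two independent grid points -/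

section Expansion

variable {d : ℕ}

/-- The deviation of the minimum is one of the two deviations, and even powers are nonnegative. -/
lemma inf_sub_pow_le {k : ℕ} (hk : Even k) (y z x : Fin d → ℝ) (j : Fin d) :
    ((y ⊓ z) j - x j) ^ k ≤ (y j - x j) ^ k + (z j - x j) ^ k := by
  rw [Pi.inf_apply]
  have h1 := hk.pow_nonneg (y j - x j)
  have h2 := hk.pow_nonneg (z j - x j)
  rcases le_total (y j) (z j) with h | h
  · rw [inf_eq_left.2 h]; linarith
  · rw [inf_eq_right.2 h]; linarith

lemma abs_sum_sum_mul_le {a : Fin d → Fin d → ℝ} {K : ℝ} (ha : ∀ i j, |a i j| ≤ K)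
    (hK : 0 ≤ K) (h : Fin d → ℝ) :
    |∑ i, ∑ j, a i j * (h i * h j)| ≤ K * (d * ∑ j, h j ^ 2) := by
  calc _ ≤ ∑ i, ∑ j, K * (|h i| * |h j|) := by
        refine (Finset.abs_sum_le_sum_abs _ _).trans (Finset.sum_le_sum fun i _ => ?_)
        refine (Finset.abs_sum_le_sum_abs _ _).trans (Finset.sum_le_sum fun j _ => ?_)
        rw [abs_mul, abs_mul]
        exact mul_le_mul_of_nonneg_right (ha i j) (by positivity)
    _ = K * (∑ i, |h i|) ^ 2 := by
        rw [sq, Finset.sum_mul_sum, Finset.mul_sum]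
        simp_rw [Finset.mul_sum]
    _ ≤ _ := by
        refine mul_le_mul_of_nonneg_left ?_ hK
        simpa using sq_sum_le_card_mul_sum_sq (s := Finset.univ) (f := fun i => |h i|)

variable [NeZero d] {μ : Measure (Fin d → ℝ)} [IsProbabilityMeasure μ]

/-- At the accuracy needed for the variance the quadratic Taylor term is itself an error of order
1/m_min, so only the linear term is kept. -/
lemma exists_abs_integral_distFun_inf_sub_sum_le (hF : RegularInterior (distFun μ))
    {S : Set (Fin d → ℝ)} (hS : IsCompact S) (hSpos : S ⊆ interiorOrthant d) :
    ∃ C : ℝ, 0 ≤ C ∧ ∀ m : Fin d → ℕ, (∀ j, 0 < m j) → ∀ x ∈ S,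
      |(∫ p : (Fin d → ℕ) × (Fin d → ℕ), distFun μ (gridPoint m p.1 ⊓ gridPoint m p.2)
          ∂((poissonProd m x).prod (poissonProd m x))) -
        (distFun μ x + ∑ j, partialDeriv j (distFun μ) x *
          -(poissonMeanDiff (Real.toNNReal (m j * x j)) / (2 * m j)))| ≤ C / (mMin m : ℝ) := by
  obtain ⟨B, hB0, hB⟩ := exists_apply_le_of_isCompact hS
  obtain ⟨K, hK0, hK⟩ := exists_abs_partialDeriv_le hF hS hSpos
  obtain ⟨C, hC0, hC⟩ := exists_abs_distFun_taylor_le hF hS hSpos one_pos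
  -- The 1 is the Taylor remainder taken with ε = 1; the rest bounds the quadratic term, the factor
  -- `d` coming from Cauchy–Schwarz. The factor 2 in the witness below counts the two grid points.
  set A : ℝ := 1 + 1 / 2 * (K * d) with hA
  have hA0 : 0 ≤ A := by positivity
  refine ⟨2 * (d * (A * B + C * (3 * B ^ 2 + B))), by positivity, fun m hm x hx => ?_⟩
  have h1 : 1 ≤ mMin m := (Finset.le_inf'_iff _ _).2 fun j _ => hm j
  have h1' : (1 : ℝ) ≤ mMin m := by exact_mod_cast h1
  have hx0 : ∀ j, 0 ≤ x j := fun j => (hSpos hx j).le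
  set F := distFun μ with hFdef
  set Q2 := (poissonProd m x).prod (poissonProd m x) with hQ2
  set H : (Fin d → ℕ) × (Fin d → ℕ) → Fin d → ℝ := fun p j =>
    (gridPoint m p.1 ⊓ gridPoint m p.2) j - x j with hH
  have hbound : ∀ p : (Fin d → ℕ) × (Fin d → ℕ),
      |F (gridPoint m p.1 ⊓ gridPoint m p.2) - (F x + ∑ j, partialDeriv j F x * H p j)| ≤
      ∑ j, ((A * (gridPoint m p.1 j - x j) ^ 2 + A * (gridPoint m p.2 j - x j) ^ 2) +
        (C * (gridPoint m p.1 j - x j) ^ 4 + C * (gridPoint m p.2 j - x j) ^ 4)) := by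
    intro p
    have t1 := hC x hx (gridPoint m p.1 ⊓ gridPoint m p.2)
    have t2 := abs_sum_sum_mul_le (hK x hx).2 hK0 (H p)
    have t3 : ∑ j, (1 * H p j ^ 2 + C * H p j ^ 4) + 1 / 2 * (K * (d * ∑ j, H p j ^ 2)) =
        ∑ j, (A * H p j ^ 2 + C * H p j ^ 4) := by
      simp only [Finset.sum_add_distrib, ← Finset.mul_sum, hA]
      ring
    have t4 : ∑ j, (A * H p j ^ 2 + C * H p j ^ 4) ≤
        ∑ j, ((A * (gridPoint m p.1 j - x j) ^ 2 + A * (gridPoint m p.2 j - x j) ^ 2) +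
        (C * (gridPoint m p.1 j - x j) ^ 4 + C * (gridPoint m p.2 j - x j) ^ 4)) := by
      refine Finset.sum_le_sum fun j _ => ?_
      rw [← mul_add, ← mul_add]
      exact add_le_add
        (mul_le_mul_of_nonneg_left (inf_sub_pow_le (by decide) _ _ _ _) hA0)
        (mul_le_mul_of_nonneg_left (inf_sub_pow_le (by decide) _ _ _ _) hC0)
    refine le_trans ?_ t4
    rw [← t3]
    simp only [hH] at *
    rw [abs_le] at *
    constructor <;> linarith [t1.1, t1.2, t2.1, t2.2]
  have i1 : ∀ j ∈ Finset.univ, Integrable (fun p => partialDeriv j F x * H p j) Q2 := fun j _ =>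
    (integrable_gridPoint_inf_sub hm hx0 j).const_mul _
  have i2 : Integrable (fun p => ∑ j, partialDeriv j F x * H p j) Q2 := integrable_finsetSum _ i1
  have i3 : Integrable (fun p => F x + ∑ j, partialDeriv j F x * H p j) Q2 :=
    (integrable_const _).add i2
  have f (j : Fin d) (b : ℝ) (a : ℕ) : Integrable (fun p : (Fin d → ℕ) × (Fin d → ℕ) =>
      b * (gridPoint m p.1 j - x j) ^ a) Q2 :=
    (integrable_fst_gridPoint_sub_pow hm hx0 j a).const_mul b
  have g (j : Fin d) (b : ℝ) (a : ℕ) : Integrable (fun p : (Fin d → ℕ) × (Fin d → ℕ) =>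
      b * (gridPoint m p.2 j - x j) ^ a) Q2 :=
    (integrable_snd_gridPoint_sub_pow hm hx0 j a).const_mul b
  have fg (j : Fin d) (b : ℝ) (a : ℕ) : Integrable (fun p : (Fin d → ℕ) × (Fin d → ℕ) =>
      b * (gridPoint m p.1 j - x j) ^ a + b * (gridPoint m p.2 j - x j) ^ a) Q2 :=
    (f j b a).add (g j b a)
  have j5 : ∀ j ∈ Finset.univ, Integrable (fun p : (Fin d → ℕ) × (Fin d → ℕ) =>
      (A * (gridPoint m p.1 j - x j) ^ 2 + A * (gridPoint m p.2 j - x j) ^ 2) +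
        (C * (gridPoint m p.1 j - x j) ^ 4 + C * (gridPoint m p.2 j - x j) ^ 4)) Q2 :=
    fun j _ => (fg j A 2).add (fg j C 4)
  have key := abs_integral_sub_integral_le (ρ := Q2) (integrable_distFun_comp
    (fun p : (Fin d → ℕ) × (Fin d → ℕ) => gridPoint m p.1 ⊓ gridPoint m p.2))
    i3 (integrable_finsetSum _ j5) hbound
  rw [integral_add (integrable_const _) i2, integral_finsetSum _ i1, integral_finsetSum _ j5]
    at key
  have e : ∀ j, ∫ p : (Fin d → ℕ) × (Fin d → ℕ),
      ((A * (gridPoint m p.1 j - x j) ^ 2 + A * (gridPoint m p.2 j - x j) ^ 2) +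
        (C * (gridPoint m p.1 j - x j) ^ 4 + C * (gridPoint m p.2 j - x j) ^ 4)) ∂Q2 =
      2 * (A * ∫ k, (gridPoint m k j - x j) ^ 2 ∂(poissonProd m x) +
      C * ∫ k, (gridPoint m k j - x j) ^ 4 ∂(poissonProd m x)) := by
    intro j
    rw [integral_add (fg j A 2) (fg j C 4), integral_add (f j A 2) (g j A 2),
      integral_add (f j C 4) (g j C 4)]
    simp only [integral_const_mul, hQ2, integral_fst_gridPoint_sub_pow,
      integral_snd_gridPoint_sub_pow]
    ring
  have e2 : ∀ j, ∫ p, partialDeriv j F x * H p j ∂Q2 = partialDeriv j F x *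
      -(poissonMeanDiff (Real.toNNReal (m j * x j)) / (2 * m j)) := fun j => by
    rw [integral_const_mul]
    simp only [hH, hQ2, integral_gridPoint_inf_sub hm hx0 j]
  simp only [e, e2, ← Finset.mul_sum, integral_const, probReal_univ, one_smul] at key
  have hrem := integral_gridPoint_remainder_le hm h1 hx0 (hB x hx) hA0 hC0
  refine key.trans ?_
  have hC4 : C * (3 * B ^ 2 + B) / (mMin m : ℝ) ^ 2 ≤ C * (3 * B ^ 2 + B) / mMin m := by
    have := le_self_pow₀ h1' (two_ne_zero)
    gcongr
  have e3 : 2 * (d * (A * B + C * (3 * B ^ 2 + B))) / (mMin m : ℝ) =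
      2 * (d * (A * B / mMin m + C * (3 * B ^ 2 + B) / mMin m)) := by ring
  rw [e3]
  have hd : (0 : ℝ) ≤ d := by positivity
  nlinarith [mul_le_mul_of_nonneg_left hC4 hd]

/-- The expansion of the mean of `F` at the minimum of two independent grid points. -/
lemma exists_abs_integral_distFun_inf_sub_le (hF : RegularInterior (distFun μ))
    {S : Set (Fin d → ℝ)} (hS : IsCompact S) (hSpos : S ⊆ interiorOrthant d) {ε : ℝ}
    (hε : 0 < ε) :
    ∃ M : ℕ, ∀ m : Fin d → ℕ, (∀ j, 0 < m j) → M ≤ mMin m → ∀ x ∈ S,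
      |(∫ p : (Fin d → ℕ) × (Fin d → ℕ), distFun μ (gridPoint m p.1 ⊓ gridPoint m p.2)
          ∂((poissonProd m x).prod (poissonProd m x))) -
        (distFun μ x - ∑ j, (√(m j : ℝ))⁻¹ * partialDeriv j (distFun μ) x *
          √(x j / Real.pi))| ≤ ε * (√(mMin m : ℝ))⁻¹ := by
  obtain ⟨B, hB0, hB⟩ := exists_apply_le_of_isCompact hS
  obtain ⟨c, hc0, hc⟩ := exists_le_apply_of_isCompact hS hSpos
  obtain ⟨K, hK0, hK⟩ := exists_abs_partialDeriv_le hF hS hSpos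
  obtain ⟨C, hC0, hC⟩ := exists_abs_integral_distFun_inf_sub_sum_le hF hS hSpos
  -- Each of the `d` coordinates contributes at most η K √B / √m_min, so together they use half of
  -- ε. The other half pays for the O(1/m_min) error.
  set η : ℝ := ε / (2 * (d * (K * √B) + 1)) with hη_def
  have hη : 0 < η := by positivity
  obtain ⟨Λ, hΛ⟩ := exists_abs_poissonMeanDiff_sub_le hη
  obtain ⟨M₁, hM₁⟩ := exists_div_le_mul_inv_sqrt (C := C) (half_pos hε)
  -- As `c` bounds all coordinates on `S` from below, m_j x_j ≥ m_min c ≥ Λ for every `j` and every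
  -- `x` in `S`.
  obtain ⟨M₂, hM₂⟩ := exists_nat_gt (Λ / c)
  refine ⟨M₁ + M₂, fun m hm hmM x hx => ?_⟩
  have h1 : 1 ≤ mMin m := (Finset.le_inf'_iff _ _).2 fun j _ => hm j
  have hmm : (0 : ℝ) < mMin m := by exact_mod_cast h1
  have hterm : ∀ j, |partialDeriv j (distFun μ) x *
      -(poissonMeanDiff (Real.toNNReal (m j * x j)) / (2 * m j)) +
      (√(m j : ℝ))⁻¹ * partialDeriv j (distFun μ) x * √(x j / Real.pi)| ≤
      η * (K * √B) * (√(mMin m : ℝ))⁻¹ := by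
    intro j
    have hmj : (mMin m : ℝ) ≤ m j := by exact_mod_cast mMin_le m j
    have hm0 : (0 : ℝ) < m j := hmm.trans_le hmj
    have hxj : 0 < x j := hSpos hx j
    have hr : ((Real.toNNReal (m j * x j) : ℝ≥0) : ℝ) = m j * x j :=
      Real.coe_toNNReal _ (by positivity)
    have hΛr : Λ ≤ (Real.toNNReal (m j * x j) : ℝ) := by
      rw [hr]
      have h2 : (M₂ : ℝ) ≤ mMin m := by exact_mod_cast (by omega : M₂ ≤ mMin m)
      have h3 : Λ ≤ mMin m * c := (div_le_iff₀ hc0).1 (hM₂.le.trans h2)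
      exact h3.trans (mul_le_mul hmj (hc x hx j) hc0.le hm0.le)
    have h := hΛ _ hΛr (by rw [hr]; positivity)
    rw [hr] at h
    have hs : 0 < √(m j : ℝ) := Real.sqrt_pos.2 hm0
    have hss : √(m j : ℝ) * √(m j : ℝ) = m j := Real.mul_self_sqrt hm0.le
    rw [mul_div_assoc, Real.sqrt_mul hm0.le, Real.sqrt_mul hm0.le] at h
    set P := poissonMeanDiff (Real.toNNReal (m j * x j))
    have e : partialDeriv j (distFun μ) x * -(P / (2 * m j)) +
        (√(m j : ℝ))⁻¹ * partialDeriv j (distFun μ) x * √(x j / Real.pi) =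
        -(partialDeriv j (distFun μ) x *
          ((P - 2 * (√(m j : ℝ) * √(x j / Real.pi))) / (2 * m j))) := by
      clear_value P
      generalize √(m j : ℝ) = s at hs hss
      rw [← hss]
      field_simp
      ring
    rw [e, abs_neg, abs_mul, abs_div, abs_of_pos (by positivity : 0 < 2 * (m j : ℝ))]
    have h4 : |P - 2 * (√(m j : ℝ) * √(x j / Real.pi))| / (2 * m j) ≤
        η * √B * (√(mMin m : ℝ))⁻¹ := by
      calc _ ≤ η * (√(m j : ℝ) * √(x j)) / (2 * m j) := by gcongr
        _ = η * √(x j) * (√(m j : ℝ))⁻¹ / 2 := by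
          nth_rewrite 2 [← hss]
          field_simp
        _ ≤ η * √(x j) * (√(m j : ℝ))⁻¹ := half_le_self (by positivity)
        _ ≤ _ := by
          have := hB x hx j
          gcongr
    calc _ ≤ K * (η * √B * (√(mMin m : ℝ))⁻¹) :=
          mul_le_mul ((hK x hx).1 j) h4 (by positivity) hK0
      _ = _ := by ring
  have hsum : |∑ j, (partialDeriv j (distFun μ) x *
      -(poissonMeanDiff (Real.toNNReal (m j * x j)) / (2 * m j)) +
      (√(m j : ℝ))⁻¹ * partialDeriv j (distFun μ) x * √(x j / Real.pi))| ≤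
      ε / 2 * (√(mMin m : ℝ))⁻¹ := by
    refine (Finset.abs_sum_le_sum_abs _ _).trans
      ((Finset.sum_le_sum fun j _ => hterm j).trans ?_)
    rw [Finset.sum_const, Finset.card_univ, Fintype.card_fin, nsmul_eq_mul, ← mul_assoc]
    refine mul_le_mul_of_nonneg_right ?_ (by positivity)
    have : (0 : ℝ) ≤ d * (K * √B) := by positivity
    rw [hη_def, div_mul_eq_mul_div, mul_div_assoc', div_le_div_iff₀ (by positivity) (by positivity)]
    nlinarith
  have hmain := (hC m hm x hx).trans (hM₁ (mMin m) (by omega))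
  rw [Finset.sum_add_distrib] at hsum
  rw [abs_le] at *
  constructor <;> linarith [hmain.1, hmain.2, hsum.1, hsum.2]

end Expansion

end SzaszMirakyan

/-! ### Assembly of the two expansions -/

theorem mainTheorem1 {d : ℕ} [NeZero d] (μ : Measure (Fin d → ℝ)) [IsProbabilityMeasure μ]
    (hsupp : ∀ᵐ y ∂μ, ∀ j, 0 ≤ y j) (hF : RegularInterior (distFun μ))
    (S : Set (Fin d → ℝ)) (hS : IsCompact S) (hSpos : S ⊆ interiorOrthant d) :
    ∀ ε : ℝ, 0 < ε → ∃ M N : ℕ, ∀ (m : Fin d → ℕ) (n : ℕ),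
      (∀ j, 0 < m j) → M ≤ mMin m → 0 < n → N ≤ n →
      ∀ (Ω : Type*) [MeasurableSpace Ω] (P : Measure Ω) [IsProbabilityMeasure P]
        (X : Fin n → Ω → (Fin d → ℝ)), (∀ i, Measurable (X i)) → (∀ i, P.map (X i) = μ) →
        iIndepFun X P →
      ∀ x ∈ S,
        MemLp (fun ω => estimator m (fun i => X i ω) x) 2 P ∧
        |((∫ ω, estimator m (fun i => X i ω) x ∂P) - distFun μ x)
            - (1 / 2) * ∑ j, x j / (m j : ℝ) * partialDeriv j (partialDeriv j (distFun μ)) x|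
          ≤ ε * (mMin m : ℝ)⁻¹ ∧
        |variance (fun ω => estimator m (fun i => X i ω) x) P
            - ((n : ℝ)⁻¹ * (distFun μ x * (1 - distFun μ x))
              - (n : ℝ)⁻¹ * ∑ j, (√(m j : ℝ))⁻¹ * partialDeriv j (distFun μ) x *
                  √(x j / Real.pi))|
          ≤ ε * ((n : ℝ)⁻¹ * (√(mMin m : ℝ))⁻¹) := by
  intro ε hε
  obtain ⟨M₁, hM₁⟩ := exists_abs_integral_distFun_sub_le hF hS hSpos hε
  obtain ⟨C, hC0, M₂, hM₂⟩ := exists_abs_integral_distFun_sub_le_div hF hS hSpos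
  obtain ⟨M₃, hM₃⟩ := exists_abs_integral_distFun_inf_sub_le hF hS hSpos (half_pos hε)
  obtain ⟨M₄, hM₄⟩ := exists_div_le_mul_inv_sqrt (C := 2 * C) (half_pos hε)
  -- The mean does not depend on `n` and the variance is exactly proportional to n⁻¹, so no
  -- threshold on `n` beyond positivity is needed.
  refine ⟨M₁ + M₂ + M₃ + M₄, 0, fun m n hm hmM hn _ Ω _ P _ X hX hlaw hind x hx => ?_⟩
  have hT : Measurable (gridPoint m) := .of_discrete
  have hest : (fun ω => estimator m (fun i => X i ω) x) = fun ω =>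
      (1 / (n : ℝ)) * ∑ i, upperProb (poissonProd m x) (gridPoint m) (X i ω) :=
    funext fun ω => estimator_eq_sum_upperProb m _ fun j => (hSpos hx j).le
  rw [hest]
  refine ⟨?_, ?_, ?_⟩
  · exact (memLp_finsetSum _ fun i _ => memLp_upperProb_comp hT hX i).const_mul _
  · rw [integral_mean_upperProb hT hn hX hlaw]
    exact hM₁ m hm (by omega) x hx
  · rw [variance_mean_upperProb hT hn hX hlaw hind]
    have h2 := hM₂ m hm (by omega) x hx
    have h3 := hM₃ m hm (by omega) x hx
    have h4 := hM₄ (mMin m) (by omega)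
    set a := ∫ k, distFun μ (gridPoint m k) ∂(poissonProd m x) with ha
    set E2 := ∫ p : (Fin d → ℕ) × (Fin d → ℕ), distFun μ (gridPoint m p.1 ⊓ gridPoint m p.2)
      ∂((poissonProd m x).prod (poissonProd m x))
    set V := ∑ j, (√(m j : ℝ))⁻¹ * partialDeriv j (distFun μ) x * √(x j / Real.pi)
    have hF01 := distFun_mem_Icc (μ := μ) x
    have ha0 : 0 ≤ a := integral_nonneg fun k => (distFun_mem_Icc _).1
    have ha1 : a ≤ 1 := by
      refine (integral_mono (integrable_distFun_comp (gridPoint m)) (integrable_const (1 : ℝ))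
        fun k => (distFun_mem_Icc _).2).trans_eq ?_
      simp
    -- Difference of squares: the sum of the two values is at most 2, and their difference is the
    -- coarse bias.
    have hsq : |a ^ 2 - distFun μ x ^ 2| ≤ 2 * C / mMin m := by
      rw [sq_sub_sq, abs_mul, abs_of_nonneg (by linarith [hF01.1]), mul_div_assoc]
      exact mul_le_mul (by linarith [hF01.2]) h2 (abs_nonneg _) (by norm_num)
    rw [← mul_sub, ← mul_sub, abs_mul, abs_of_nonneg (by positivity : (0 : ℝ) ≤ (n : ℝ)⁻¹),
      mul_left_comm]
    refine mul_le_mul_of_nonneg_left ?_ (by positivity)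
    have h5 := hsq.trans h4
    rw [abs_le] at h3 h5 ⊢
    constructor <;> nlinarith [h3.1, h3.2, h5.1, h5.2]
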